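/- Notation. Let $X_t\in\mathbb R^r$, $t\ge 0$, be a strictly stationary process with $X_t\in L^4$, mean $\mu$ and lagged covariance matrices $K(u)=\mathbb E(X_tX_{t+u}^*)-\mu\mu^*$, $u\ge 0$. For a vector or matrix $M$ let $\|M\|=\max_{i,j}|M_{i,j}|$, and for a random one let $\|M\|_p=(\mathbb E\|M\|^p)^{1/p}$. Let $f$ be a positive, continuous, decreasing function on $(0,\infty)$ with $I(f)=\int_1^\infty f(T)\,dT<\infty$. The process $X$ has integrable decorrelation rate $f$ if $|\mathbb E(GH)-\mathbb E(G)\mathbb E(H)|\le f(T)$ for any two time intervals $U,V\subset[0,\infty)$ with time gap $T=\inf_{u\in U,\,v\in V}(v-u)>0$, whenever $G$ is of the form $X_s(i)$ or $X_s(i)X_t(j)$ with $s,t\in U$, and $H$ is of the same form with times in $V$. Call $X$ admissible if it is strictly stationary, lies in $L^4$, has locally Lipschitz $u\mapsto K(u)$ on $[0,\infty)$ and has an integrable decorrelation rate. For $N=N(\varepsilon)\in\mathbb N$, $\Delta=\Delta(\varepsilon)>0$ and $u\ge 0$, let $\kappa$ be the integer closest to $u/\Delta$ and put $$\hat K_X^\varepsilon(u)=\frac1N\sum_{n=1}^N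 X_{n\Delta}X_{(n+\kappa)\Delta}^*-\Big(\frac1N\sum_{n=1}^N X_{n\Delta}\Big)\Big(\frac1N\sum_{n=1}^N X_{(n+\kappa)\Delta}\Big)^*.$$ Proposition. (1) Let $X$ be admissible with decorrelation rate $f$, let $\nu$ be an upper bound of $\|X_t\|_4$, let $A\ge 0$, and let $\lambda$ be a Lipschitz constant of (the entries of) $K$ on $[0,A+1]$. Let $N(\varepsilon)\to\infty$ as $\varepsilon\to0^+$ be arbitrary, and let $\Delta(\varepsilon)>0$ satisfy $\Delta(\varepsilon)N(\varepsilon)^{1/3}\to c$ for some $c\in(0,\infty)$. Then there is a constant $C$, depending only on $r,A,\nu,\lambda,c$ and (an upper bound of) $I(f)$, such that for all sufficiently small $\varepsilon>0$ $$\|\hat K_X^\varepsilon(u)-K(u)\|_2\le \frac{C}{N(\varepsilon)^{1/3}}\qquad\text{for all }0\le u\le A .$$ (2) Up to multiplicative constants, this uniform speed is the best obtainable under these assumptions, for any choice of the time steps: for every $r\ge1$ there is an admissible Gaussian process $X$ in $\mathbb R^r$ such that for every $A>0$ there is a constant $c'>0$ with the following property. For all $N(\varepsilon)\in\mathbb N$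 and $\Delta(\varepsilon)>0$ with $\Delta(\varepsilon)\to0$ and $N(\varepsilon)\Delta(\varepsilon)\to\infty$ as $\varepsilon\to0^+$, one has, for all sufficiently small $\varepsilon>0$, $$\sup_{0\le u\le A}\|\hat K_X^\varepsilon(u)-K(u)\|_2\ge \frac{c'}{N(\varepsilon)^{1/3}} .$$ -/

import Mathlib

open MeasureTheory ProbabilityTheory Filter Set
open scoped Topology NNReal ENNReal

universe v

/-- The index set of time is `[0, ∞)`: a process is a family `X t`, and only the values at
`t ≥ 0` matter. Strict stationarity: the finite-dimensional laws at nonnegative times are invariant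
under shifts to the right. -/
def IsStrictlyStationary {Ω : Type*} [MeasurableSpace Ω] {r : ℕ} (P : Measure Ω)
    (X : ℝ → Ω → Fin r → ℝ) : Prop :=
  ∀ (n : ℕ) (t : Fin n → ℝ) (h : ℝ), (∀ k, 0 ≤ t k) → 0 ≤ h →
    P.map (fun ω k => X (t k + h) ω) = P.map (fun ω k => X (t k) ω)

/-- The lagged covariance matrix `K(u) = E(X_0 X_u^*) - μ μ^*` with `μ = E(X_0)`. -/
noncomputable def laggedCov {Ω : Type*} [MeasurableSpace Ω] {r : ℕ} (P : Measure Ω)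
    (X : ℝ → Ω → Fin r → ℝ) (u : ℝ) : Matrix (Fin r) (Fin r) ℝ :=
  Matrix.of fun i j =>
    (∫ ω, X 0 ω i * X u ω j ∂P) - (∫ ω, X 0 ω i ∂P) * (∫ ω, X 0 ω j ∂P)

/-- The set `F_U` of all random variables `X_s(i)` and `X_s(i) X_t(j)` with `s, t ∈ U`. -/
def lagMonomials {Ω : Type*} {r : ℕ} (X : ℝ → Ω → Fin r → ℝ) (U : Set ℝ) : Set (Ω → ℝ) :=
  {G | (∃ s ∈ U, ∃ i, G = fun ω => X s ω i) ∨
    (∃ s ∈ U, ∃ t ∈ U, ∃ i j, G = fun ω => X s ω i * X t ω j)}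

/-- `X` has integrable decorrelation rate `f`: `f` is positive, continuous and decreasing on
`(0, ∞)`, integrable on `[1, ∞)`, and it bounds the covariances between `F_U` and `F_V`
for any two time intervals `U`, `V` separated by a time gap `T = inf (v - u) > 0`. -/
structure HasIntegrableDecorrelationRate {Ω : Type*} [MeasurableSpace Ω] {r : ℕ} (P : Measure Ω)
    (X : ℝ → Ω → Fin r → ℝ) (f : ℝ → ℝ) : Prop where
  pos : ∀ T, 0 < T → 0 < f T
  antitone : AntitoneOn f (Ioi 0)
  continuous : ContinuousOn f (Ioi 0)
  integrable : IntegrableOn f (Ioi 1)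
  decorrelation : ∀ (U V : Set ℝ) (T : ℝ), U ⊆ Ici 0 → V ⊆ Ici 0 →
    U.OrdConnected → V.OrdConnected → U.Nonempty → V.Nonempty →
    0 < T → IsGLB {d : ℝ | ∃ u ∈ U, ∃ v ∈ V, d = v - u} T →
    ∀ G ∈ lagMonomials X U, ∀ H ∈ lagMonomials X V,
      |(∫ ω, G ω * H ω ∂P) - (∫ ω, G ω ∂P) * (∫ ω, H ω ∂P)| ≤ f T

/-- The standing assumptions on the process: strictly stationary, in `L^4`, with locally Lipschitz
lagged covariances and integrable decorrelation rate `f`. -/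
structure IsAdmissibleProcess {Ω : Type*} [MeasurableSpace Ω] {r : ℕ} (P : Measure Ω)
    (X : ℝ → Ω → Fin r → ℝ) (f : ℝ → ℝ) : Prop where
  stationary : IsStrictlyStationary P X
  memLp : ∀ t, 0 ≤ t → MemLp (X t) 4 P
  locallyLipschitz : ∀ i j, LocallyLipschitzOn (Ici 0) (fun u => laggedCov P X u i j)
  decorrelation : HasIntegrableDecorrelationRate P X f

/-- An adaptive sub-sampling scheme: `Δ(ε) > 0`, `Δ(ε) → 0` and `N(ε) Δ(ε) → ∞` as `ε → 0+`. -/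
structure IsAdaptiveScheme (N : ℝ → ℕ) (Δ : ℝ → ℝ) : Prop where
  pos : ∀ ε, 0 < ε → 0 < Δ ε
  tendsto_zero : Tendsto Δ (𝓝[>] 0) (𝓝 0)
  tendsto_atTop : Tendsto (fun ε => (N ε : ℝ) * Δ ε) (𝓝[>] 0) atTop

/-- The sub-sampled empirical mean `(1/N) ∑_{n=1}^N X_{(n+κ)Δ}`, shifted by `κ` time steps. -/
noncomputable def shiftedMean {Ω : Type*} {r : ℕ} (X : ℝ → Ω → Fin r → ℝ)
    (N : ℕ) (Δ : ℝ) (κ : ℤ) (ω : Ω) : Fin r → ℝ :=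
  (1 / (N : ℝ)) • ∑ n ∈ Finset.Icc 1 N, X (((n : ℝ) + (κ : ℝ)) * Δ) ω

/-- The sub-sampled empirical lagged covariance matrix at lag `u`, where `κ` is the integer closest
to `u / Δ`. -/
noncomputable def empiricalCov {Ω : Type*} {r : ℕ} (X : ℝ → Ω → Fin r → ℝ)
    (N : ℕ) (Δ u : ℝ) (ω : Ω) : Matrix (Fin r) (Fin r) ℝ :=
  (1 / (N : ℝ)) • (∑ n ∈ Finset.Icc 1 N,
      Matrix.vecMulVec (X ((n : ℝ) * Δ) ω) (X (((n : ℝ) + (round (u / Δ) : ℝ)) * Δ) ω))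
    - Matrix.vecMulVec (shiftedMean X N Δ 0 ω) (shiftedMean X N Δ (round (u / Δ)) ω)

/-- `‖M‖_2 = (E ‖M‖²)^{1/2}` for a random matrix, where `‖M‖` is the largest absolute value of
the entries (the norm of the product space `Fin r → Fin r → ℝ`). -/
noncomputable def matrixL2Norm {Ω : Type*} [MeasurableSpace Ω] {r : ℕ} (P : Measure Ω)
    (M : Ω → Matrix (Fin r) (Fin r) ℝ) : ℝ≥0∞ :=
  eLpNorm (fun ω => (Matrix.of.symm (M ω) : Fin r → Fin r → ℝ)) 2 P

/-- The `L^2` estimation error `‖K̂_X(u) - K(u)‖_2` for `N` observations with time step `Δ`. -/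
noncomputable def covError {Ω : Type*} [MeasurableSpace Ω] {r : ℕ} (P : Measure Ω)
    (X : ℝ → Ω → Fin r → ℝ) (N : ℕ) (Δ u : ℝ) : ℝ≥0∞ :=
  matrixL2Norm P (fun ω => empiricalCov X N Δ u ω - laggedCov P X u)

/-! Upper bound. Write `k` for the rounded lag. An entry of the error is `V + b - Z * Y - μj * Z -
μi * Y`: `V` is the fluctuation of the averaged lagged products, `b = K(kΔ) - K(u)` is the bias from
rounding the lag, and `Z`, `Y` are the centred empirical means. The Lipschitz property gives `|b| ≤
LΔ`. The variance of an average over `N` grid points is `N⁻²` times a double sum of covariances.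
These are bounded at short time distance and dominated by the rate `f` beyond it, so comparison with
`∫ f` bounds the sum by a multiple of `N / Δ` and the variance by a multiple of `1 / (NΔ)`
(`sum_sum_rateEnvelope_le`, `integral_sq_mean_sub_le`).

The product `Z * Y` needs fourth moments of the means. For ordered times, a centred four-point
moment is small unless one of the first two gaps is short: splitting at the middle gap leaves a
covariance, controlled by that gap, and a product of two pair moments, controlled by the first gap.
Summation again gives order `1 / (NΔ)`, which suffices. Altogether the squared error is at most a
multiple of `1 / (NΔ) + Δ²` (`integral_sq_entry_le`), and `Δ ~ c N^(-1/3)` makes both terms of order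
`N^(-2/3)`.

Lower bound. The process consists of independent unit increments `B_{t+1} - B_t` of Brownian
motions, realised as white noise evaluated on sliding windows, with covariance `(1 - |u|)₊`. Its
slope near `0` produces a bias of at least `Δ / 4` at the off-grid lag `3Δ / 4`
(`bias_le_covError`). At lag `0`, Wick's formula gives fluctuations of order `(NΔ)^(-1/2)`
(`fluctuation_le_covError`). If `Δ ≥ N^(-1/3)` the bias is too large, otherwise the fluctuations
are. -/

/-! ### Construction of isonormal Gaussian processes -/

section Isonormal

/-- The elements of `L²` whose characteristic function is that of a centred Gaussian variable. -/
def centeredGaussianSet {Ω : Type*} [MeasurableSpace Ω] (P : Measure Ω) : Set (Lp ℝ 2 P) :=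
  {Z | ∀ s : ℝ, ∫ ω, Complex.exp (Complex.I * ((s * Z ω : ℝ) : ℂ)) ∂P
    = Complex.exp ((-(s ^ 2 * ‖Z‖ ^ 2) / 2 : ℝ) : ℂ)}

lemma norm_exp_I_mul_sub_exp_I_mul_le (a b : ℝ) :
    ‖Complex.exp (Complex.I * (a : ℂ)) - Complex.exp (Complex.I * (b : ℂ))‖ ≤ |a - b| := by
  have h : Complex.exp (Complex.I * (a : ℂ)) - Complex.exp (Complex.I * (b : ℂ))
      = Complex.exp (Complex.I * (b : ℂ)) * (Complex.exp (Complex.I * ((a - b : ℝ) : ℂ)) - 1) := by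
    rw [mul_sub, ← Complex.exp_add]; push_cast; ring_nf
  rw [h, norm_mul, Complex.norm_exp_I_mul_ofReal, one_mul]
  exact Real.norm_exp_I_mul_ofReal_sub_one_le

lemma integrable_exp_I_mul {Ω : Type*} [MeasurableSpace Ω] {P : Measure Ω} [IsProbabilityMeasure P]
    {Z : Ω → ℝ} (hZ : AEStronglyMeasurable Z P) (s : ℝ) :
    Integrable (fun ω => Complex.exp (Complex.I * ((s * Z ω : ℝ) : ℂ))) P := by
  refine Integrable.of_bound ?_ 1 (ae_of_all _ fun ω => ?_)
  · exact (by fun_prop : Continuous fun x : ℝ =>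
      Complex.exp (Complex.I * ((s * x : ℝ) : ℂ))).comp_aestronglyMeasurable hZ
  · rw [Complex.norm_exp_I_mul_ofReal]

/-- Characteristic functions and norms are continuous in `L²`, so Gaussianity survives `L²` limits.
This passes from finite combinations of a basis to the whole Hilbert space. -/
lemma isClosed_centeredGaussianSet {Ω : Type*} [MeasurableSpace Ω] (P : Measure Ω)
    [IsProbabilityMeasure P] : IsClosed (centeredGaussianSet P) := by
  have hset : centeredGaussianSet P = ⋂ s : ℝ, {Z : Lp ℝ 2 P |
      ∫ ω, Complex.exp (Complex.I * ((s * Z ω : ℝ) : ℂ)) ∂P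
        = Complex.exp ((-(s ^ 2 * ‖Z‖ ^ 2) / 2 : ℝ) : ℂ)} := by
    ext; simp [centeredGaussianSet]
  rw [hset]
  refine isClosed_iInter fun s => isClosed_eq ?_ (by fun_prop)
  -- The Lipschitz constant comes from `|e^{ia} - e^{ib}| ≤ |a - b|` and from the `L¹` norm being at
  -- most the `L²` norm on a probability space.
  refine (LipschitzWith.of_dist_le_mul (K := ‖s‖₊) fun Z Z' => ?_).continuous
  rw [dist_eq_norm, dist_eq_norm, ← integral_sub
    (integrable_exp_I_mul (Lp.aestronglyMeasurable Z) s)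
    (integrable_exp_I_mul (Lp.aestronglyMeasurable Z') s)]
  have hint : Integrable (fun ω => (Z - Z' : Lp ℝ 2 P) ω) P :=
    (Lp.memLp (Z - Z')).integrable (by norm_num)
  calc ‖∫ ω, (Complex.exp (Complex.I * ((s * Z ω : ℝ) : ℂ))
        - Complex.exp (Complex.I * ((s * Z' ω : ℝ) : ℂ))) ∂P‖
      ≤ ∫ ω, ‖s‖ * ‖(Z - Z' : Lp ℝ 2 P) ω‖ ∂P := by
        refine norm_integral_le_of_norm_le (hint.norm.const_mul _) ?_
        filter_upwards [Lp.coeFn_sub Z Z'] with ω hω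
        refine (norm_exp_I_mul_sub_exp_I_mul_le _ _).trans (le_of_eq ?_)
        rw [hω, Pi.sub_apply, ← mul_sub, abs_mul]; rfl
    _ = ‖s‖ * ∫ ω, ‖(Z - Z' : Lp ℝ 2 P) ω‖ ∂P := integral_const_mul _ _
    _ ≤ ‖s‖ * ‖Z - Z'‖ := by
        gcongr
        rw [Lp.norm_def, integral_norm_eq_lintegral_enorm hint.aestronglyMeasurable]
        refine ENNReal.toReal_mono (Lp.eLpNorm_ne_top _) ?_
        rw [← eLpNorm_one_eq_lintegral_enorm]
        exact eLpNorm_le_eLpNorm_of_exponent_le (by norm_num) hint.aestronglyMeasurable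

lemma sq_norm_Lp_eq_integral {Ω : Type*} [MeasurableSpace Ω] {P : Measure Ω} (Z : Lp ℝ 2 P) :
    ‖Z‖ ^ 2 = ∫ ω, Z ω ^ 2 ∂P := by
  rw [← real_inner_self_eq_norm_sq, L2.inner_def]
  simp [sq]

lemma mem_centeredGaussianSet_of_hasGaussianLaw {Ω : Type*} [MeasurableSpace Ω] {P : Measure Ω}
    [IsProbabilityMeasure P] {Z : Lp ℝ 2 P} (h : HasGaussianLaw Z P) (h0 : ∫ ω, Z ω ∂P = 0) :
    Z ∈ centeredGaussianSet P := by
  intro s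
  have hm := h.map_eq_gaussianReal
  have hv : Var[Z; P] = ‖Z‖ ^ 2 := by
    rw [sq_norm_Lp_eq_integral, variance_of_integral_eq_zero h.aemeasurable h0]
  have hc := charFun_gaussianReal (μ := P[Z]) (v := Var[Z; P].toNNReal) s
  rw [← hm, charFun_apply_real, integral_map h.aemeasurable
    (by fun_prop), h0, hv] at hc
  calc _ = ∫ ω, Complex.exp (s * (Z ω : ℂ) * Complex.I) ∂P := by
        congr 1; ext ω; push_cast; ring_nf
    _ = _ := by
        rw [hc, Real.coe_toNNReal _ (by positivity)]; congr 1; push_cast; ring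

lemma map_eq_gaussianReal_of_mem_centeredGaussianSet {Ω : Type*} [MeasurableSpace Ω]
    {P : Measure Ω} [IsProbabilityMeasure P] {Z : Lp ℝ 2 P} (h : Z ∈ centeredGaussianSet P) :
    P.map Z = gaussianReal 0 (‖Z‖ ^ 2).toNNReal := by
  have hZ : AEMeasurable Z P := (Lp.aestronglyMeasurable Z).aemeasurable
  have := Measure.isProbabilityMeasure_map hZ
  refine Measure.ext_of_charFun ?_
  ext s
  rw [charFun_gaussianReal, charFun_apply_real, integral_map hZ (by fun_prop)]
  calc _ = ∫ ω, Complex.exp (Complex.I * ((s * Z ω : ℝ) : ℂ)) ∂P := by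
        congr 1; ext ω; push_cast; ring_nf
    _ = _ := by
        rw [h s, Real.coe_toNNReal _ (by positivity)]; congr 1; push_cast; ring

/-- Every Hilbert space carries an isonormal Gaussian process. -/
theorem exists_isonormal (H : Type) [NormedAddCommGroup H] [InnerProductSpace ℝ H]
    [CompleteSpace H] :
    ∃ (Ω : Type) (_ : MeasurableSpace Ω) (P : Measure Ω) (_ : IsProbabilityMeasure P)
      (W : H →ₗᵢ[ℝ] Lp ℝ 2 P), ∀ h, P.map (W h) = gaussianReal 0 (‖h‖ ^ 2).toNNReal := by
  obtain ⟨w, b, -⟩ := exists_hilbertBasis ℝ H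
  obtain ⟨Ω, mΩ, P, ξ, hξm, hξ, hind, hP⟩ := exists_iid w (gaussianReal 0 1)
  have hG : ∀ i, HasGaussianLaw (ξ i) P := fun i => (hξ i).hasGaussianLaw
  have hLp : ∀ i, MemLp (ξ i) 2 P := fun i => (hG i).memLp_two
  have hmean : ∀ i, ∫ ω, ξ i ω ∂P = 0 := fun i => by
    rw [(hξ i).integral_eq, integral_id_gaussianReal]
  have hvar : ∀ i, Var[ξ i; P] = 1 := fun i => by
    rw [(hξ i).variance_eq, variance_id_gaussianReal]; simp
  have hsq : ∀ i, ∫ ω, ξ i ω * ξ i ω ∂P = 1 := fun i => by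
    rw [← hvar i, variance_of_integral_eq_zero (hξm i).aemeasurable (hmean i)]
    simp [sq]
  have hort : Orthonormal ℝ (fun i => (hLp i).toLp (ξ i)) := by
    classical
    rw [orthonormal_iff_ite]
    intro i j
    have : inner ℝ ((hLp i).toLp (ξ i)) ((hLp j).toLp (ξ j)) = ∫ ω, ξ i ω * ξ j ω ∂P := by
      rw [L2.inner_def]
      refine integral_congr_ae ?_
      filter_upwards [(hLp i).coeFn_toLp, (hLp j).coeFn_toLp] with ω h1 h2
      simp [h1, h2, mul_comm]
    rw [this]
    split_ifs with hij
    · subst hij; exact hsq i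
    · rw [(hind.indepFun hij).integral_fun_mul_eq_mul_integral (hξm i).aestronglyMeasurable
        (hξm j).aestronglyMeasurable, hmean, zero_mul]
  -- Finite combinations of independent standard Gaussians are centred Gaussian; general vectors are
  -- limits of these.
  have hfin : ∀ (a : w → ℝ) (s : Finset w),
      (∑ i ∈ s, a i • (hLp i).toLp (ξ i)) ∈ centeredGaussianSet P := by
    intro a s
    have hae : (∑ i ∈ s, a i • (hLp i).toLp (ξ i) : Lp ℝ 2 P)
        =ᵐ[P] fun ω => ∑ i ∈ s, a i * ξ i ω := by
      have h2 : ∀ᵐ ω ∂P, ∀ i ∈ s, (a i • (hLp i).toLp (ξ i) : Lp ℝ 2 P) ω = a i * ξ i ω := by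
        refine (Finset.eventually_all s).2 ?_
        intro i _
        filter_upwards [Lp.coeFn_smul (a i) ((hLp i).toLp (ξ i)), (hLp i).coeFn_toLp] with ω h1 h2
        rw [h1, Pi.smul_apply, h2, smul_eq_mul]
      filter_upwards [Lp.coeFn_finsetSum s (fun i => a i • (hLp i).toLp (ξ i)), h2] with ω h1 h2
      rw [h1, Finset.sum_apply]
      exact Finset.sum_congr rfl h2
    have hlaw : HasGaussianLaw (fun ω => ∑ i ∈ s, a i * ξ i ω) P := by
      have h1 : HasGaussianLaw (fun ω => (fun i : s => ξ i ω)) P :=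
        iIndepFun.hasGaussianLaw (fun i => hG i) (hind.precomp Subtype.val_injective)
      have h2 := h1.map_fun (∑ i : s, (a i) • ContinuousLinearMap.proj (R := ℝ)
        (φ := fun _ : s => ℝ) i)
      refine h2.congr (ae_of_all _ fun ω => ?_)
      simp [sum_apply, Finset.sum_attach s (fun i => a i * ξ i ω)]
    refine mem_centeredGaussianSet_of_hasGaussianLaw (hlaw.congr hae.symm) ?_
    rw [integral_congr_ae hae, integral_finsetSum]
    · simp [integral_const_mul, hmean]
    · exact fun i _ => (hG i).integrable.const_mul _
  -- `W` sends the Hilbert basis to the orthonormal i.i.d. family, so the expansion of `h` becomes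
  -- an `L²`-convergent series of Gaussians.
  let V := hort.orthogonalFamily.linearIsometry
  refine ⟨Ω, mΩ, P, hP, V.comp b.repr.toLinearIsometry, fun h => ?_⟩
  rw [map_eq_gaussianReal_of_mem_centeredGaussianSet, LinearIsometry.norm_map]
  have hsum := hort.orthogonalFamily.hasSum_linearIsometry (b.repr h)
  refine (isClosed_centeredGaussianSet P).mem_of_tendsto hsum (Eventually.of_forall fun s => ?_)
  simpa using hfin (fun i => b.repr h i) s


/-! ### Gaussian moments up to order four and Wick's formula -/

lemma deriv_mul_exp_sq (v : ℝ) {p p' : ℝ → ℝ} (hp : ∀ t, HasDerivAt p (p' t) t) :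
    deriv (fun t => p t * Real.exp (v * t ^ 2 / 2))
      = fun t => (p' t + v * t * p t) * Real.exp (v * t ^ 2 / 2) := by
  ext t
  have h1 : HasDerivAt (fun t : ℝ => v * t ^ 2 / 2) (v * t) t := by
    refine (((hasDerivAt_pow 2 t).const_mul v).div_const 2).congr_deriv ?_
    push_cast; ring
  rw [((hp t).fun_mul h1.exp).deriv]
  ring

lemma iteratedDeriv_exp_sq (v : ℝ) :
    iteratedDeriv 3 (fun t : ℝ => Real.exp (v * t ^ 2 / 2))
      = fun t => (3 * v ^ 2 * t + v ^ 3 * t ^ 3) * Real.exp (v * t ^ 2 / 2) := by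
  have h0 : (fun t : ℝ => Real.exp (v * t ^ 2 / 2))
      = fun t => (fun _ : ℝ => (1 : ℝ)) t * Real.exp (v * t ^ 2 / 2) := by simp
  rw [iteratedDeriv_succ, iteratedDeriv_succ, iteratedDeriv_one, h0,
    deriv_mul_exp_sq v (p' := fun _ => 0) (fun t => hasDerivAt_const t 1),
    deriv_mul_exp_sq v (p := fun t => 0 + v * t * 1) (p' := fun _ => v) (fun t => by
      simpa using (hasDerivAt_id t).const_mul v),
    deriv_mul_exp_sq v (p := fun t => v + v * t * (0 + v * t * 1)) (p' := fun t => 2 * v ^ 2 * t)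
      (fun t => by
        have h2 : (fun t => v + v * t * (0 + v * t * 1)) = fun t => v + v ^ 2 * t ^ 2 := by
          ext t; ring
        rw [h2]
        refine (((hasDerivAt_pow 2 t).const_mul (v ^ 2)).const_add v).congr_deriv ?_
        push_cast; ring)]
  ext t; ring

/-- The moments of order three and four are derivatives at `0` of the moment generating function
`exp(v t² / 2)`. -/
lemma integral_pow_three_gaussianReal (v : ℝ≥0) : ∫ x, x ^ 3 ∂(gaussianReal 0 v) = 0 := by
  have h := iteratedDeriv_mgf_zero (X := id) (μ := gaussianReal 0 v) (by simp) 3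
  rw [mgf_id_gaussianReal] at h
  simp only [zero_mul, zero_add, iteratedDeriv_exp_sq] at h
  simpa using h.symm

lemma integral_pow_four_gaussianReal (v : ℝ≥0) :
    ∫ x, x ^ 4 ∂(gaussianReal 0 v) = 3 * (v : ℝ) ^ 2 := by
  have h := iteratedDeriv_mgf_zero (X := id) (μ := gaussianReal 0 v) (by simp) 4
  rw [mgf_id_gaussianReal] at h
  simp only [zero_mul, zero_add] at h
  rw [iteratedDeriv_succ, iteratedDeriv_exp_sq,
    deriv_mul_exp_sq (v : ℝ) (p' := fun t => 3 * (v : ℝ) ^ 2 + 3 * (v : ℝ) ^ 3 * t ^ 2) (fun t => by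
        refine (((hasDerivAt_id t).const_mul (3 * (v : ℝ) ^ 2)).fun_add
          ((hasDerivAt_pow 3 t).const_mul ((v : ℝ) ^ 3))).congr_deriv ?_
        push_cast; ring)] at h
  simpa using h.symm

variable {H : Type*} [NormedAddCommGroup H] [InnerProductSpace ℝ H]
  {Ω : Type*} [MeasurableSpace Ω] {P : Measure Ω} {W : H →ₗᵢ[ℝ] Lp ℝ 2 P}

lemma isonormal_hasGaussianLaw (hW : ∀ h, P.map (W h) = gaussianReal 0 (‖h‖ ^ 2).toNNReal)
    (h : H) : HasGaussianLaw (W h) P :=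
  ⟨by rw [hW]; infer_instance⟩

lemma isonormal_aemeasurable (h : H) : AEMeasurable (W h) P :=
  (Lp.aestronglyMeasurable (W h)).aemeasurable

lemma isonormal_integral (hW : ∀ h, P.map (W h) = gaussianReal 0 (‖h‖ ^ 2).toNNReal) (h : H) :
    ∫ ω, W h ω ∂P = 0 := by
  rw [← integral_map (φ := W h) (f := fun x => x) (isonormal_aemeasurable h)
    (by fun_prop), hW, integral_id_gaussianReal]

lemma isonormal_integral_mul (h k : H) : ∫ ω, W h ω * W k ω ∂P = inner ℝ h k := by
  rw [← W.inner_map_map, L2.inner_def]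
  simp [mul_comm]

lemma isonormal_integral_pow_three (hW : ∀ h, P.map (W h) = gaussianReal 0 (‖h‖ ^ 2).toNNReal)
    (h : H) : ∫ ω, W h ω ^ 3 ∂P = 0 := by
  rw [← integral_map (φ := W h) (f := fun x => x ^ 3) (isonormal_aemeasurable h)
    (by fun_prop), hW, integral_pow_three_gaussianReal]

lemma isonormal_integral_pow_four (hW : ∀ h, P.map (W h) = gaussianReal 0 (‖h‖ ^ 2).toNNReal)
    (h : H) : ∫ ω, W h ω ^ 4 ∂P = 3 * (inner ℝ h h) ^ 2 := by
  rw [← integral_map (φ := W h) (f := fun x => x ^ 4) (isonormal_aemeasurable h)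
    (by fun_prop), hW, integral_pow_four_gaussianReal, Real.coe_toNNReal _ (by positivity),
    real_inner_self_eq_norm_sq]

lemma isonormal_memLp (hW : ∀ h, P.map (W h) = gaussianReal 0 (‖h‖ ^ 2).toNNReal) (h : H)
    (p : ℝ≥0) : MemLp (W h) p P :=
  (isonormal_hasGaussianLaw hW h).memLp (by simp)

lemma isonormal_integrable_pow (hW : ∀ h, P.map (W h) = gaussianReal 0 (‖h‖ ^ 2).toNNReal) (h : H)
    (n : ℕ) : Integrable (fun ω => W h ω ^ n) P := by
  have := (isonormal_hasGaussianLaw hW h).isProbabilityMeasure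
  have h1 := (isonormal_memLp hW h n).integrable_norm_pow'
  refine (integrable_norm_iff ?_).1 (by simpa using h1)
  exact (Lp.aestronglyMeasurable (W h)).pow n

lemma isonormal_add (h k : H) : W (h + k) =ᵐ[P] fun ω => W h ω + W k ω := by
  rw [map_add]; exact Lp.coeFn_add _ _

lemma isonormal_smul (c : ℝ) (h : H) : W (c • h) =ᵐ[P] fun ω => c * W h ω := by
  rw [map_smul]; exact Lp.coeFn_smul _ _

lemma isonormal_sum {ι : Type*} (s : Finset ι) (h : ι → H) :
    W (∑ i ∈ s, h i) =ᵐ[P] fun ω => ∑ i ∈ s, W (h i) ω := by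
  rw [map_sum]
  filter_upwards [Lp.coeFn_finsetSum s (fun i => W (h i))] with ω hω
  rw [hω, Finset.sum_apply]

/-- Polarisation: `24abc` is a signed sum of cubes `(a ± b ± c)³`, and each `a ± b ± c` is again the
image of a single vector, with vanishing third moment. -/
lemma isonormal_integral_mul_mul (hW : ∀ h, P.map (W h) = gaussianReal 0 (‖h‖ ^ 2).toNNReal)
    (a b c : H) : ∫ ω, W a ω * W b ω * W c ω ∂P = 0 := by
  have key : ∀ s t : ℝ, (∫ ω, (W a ω + s * W b ω + t * W c ω) ^ 3 ∂P = 0) ∧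
      Integrable (fun ω => (W a ω + s * W b ω + t * W c ω) ^ 3) P := by
    intro s t
    have hae : (fun ω => W (a + s • b + t • c) ω ^ 3)
        =ᵐ[P] fun ω => (W a ω + s * W b ω + t * W c ω) ^ 3 := by
      filter_upwards [isonormal_add (W := W) (a + s • b) (t • c), isonormal_add (W := W) a (s • b),
        isonormal_smul (W := W) s b, isonormal_smul (W := W) t c] with ω h1 h2 h3 h4
      rw [h1, h2, h3, h4]
    exact ⟨by rw [← integral_congr_ae hae, isonormal_integral_pow_three hW],
      (isonormal_integrable_pow hW _ 3).congr hae⟩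
  have e : (fun ω => W a ω * W b ω * W c ω) = fun ω => (1 / 24 : ℝ) *
      ((W a ω + 1 * W b ω + 1 * W c ω) ^ 3 - (W a ω + 1 * W b ω + (-1) * W c ω) ^ 3
        - (W a ω + (-1) * W b ω + 1 * W c ω) ^ 3 + (W a ω + (-1) * W b ω + (-1) * W c ω) ^ 3) := by
    ext ω; ring
  rw [e, integral_const_mul, integral_add _ (key _ _).2, integral_sub _ (key _ _).2,
    integral_sub (key _ _).2 (key _ _).2, (key _ _).1, (key _ _).1, (key _ _).1, (key _ _).1]
  · ring
  · exact (key _ _).2.sub (key _ _).2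
  · exact ((key _ _).2.sub (key _ _).2).sub (key _ _).2

/-- Wick's formula for products of four Gaussian variables. -/
theorem isonormal_wick (hW : ∀ h, P.map (W h) = gaussianReal 0 (‖h‖ ^ 2).toNNReal)
    (a b c d : H) : Integrable (fun ω => W a ω * W b ω * (W c ω * W d ω)) P ∧
    ∫ ω, W a ω * W b ω * (W c ω * W d ω) ∂P
      = inner ℝ a b * inner ℝ c d + inner ℝ a c * inner ℝ b d + inner ℝ a d * inner ℝ b c := by
  have key : ∀ s t u : ℝ, (∫ ω, (W a ω + s * W b ω + t * W c ω + u * W d ω) ^ 4 ∂P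
        = 3 * (inner ℝ a a + s ^ 2 * inner ℝ b b + t ^ 2 * inner ℝ c c + u ^ 2 * inner ℝ d d
          + 2 * s * inner ℝ a b + 2 * t * inner ℝ a c + 2 * u * inner ℝ a d
          + 2 * s * t * inner ℝ b c + 2 * s * u * inner ℝ b d + 2 * t * u * inner ℝ c d) ^ 2) ∧
      Integrable (fun ω => (W a ω + s * W b ω + t * W c ω + u * W d ω) ^ 4) P := by
    intro s t u
    have hae : (fun ω => W (a + s • b + t • c + u • d) ω ^ 4)
        =ᵐ[P] fun ω => (W a ω + s * W b ω + t * W c ω + u * W d ω) ^ 4 := by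
      filter_upwards [isonormal_add (W := W) (a + s • b + t • c) (u • d),
        isonormal_add (W := W) (a + s • b) (t • c), isonormal_add (W := W) a (s • b),
        isonormal_smul (W := W) s b, isonormal_smul (W := W) t c,
        isonormal_smul (W := W) u d] with ω h0 h1 h2 h3 h4 h5
      rw [h0, h1, h2, h3, h4, h5]
    refine ⟨?_, (isonormal_integrable_pow hW _ 4).congr hae⟩
    rw [← integral_congr_ae hae, isonormal_integral_pow_four hW]
    congr 2
    simp only [inner_add_left, inner_add_right, real_inner_smul_left, real_inner_smul_right]
    rw [real_inner_comm a b, real_inner_comm a c, real_inner_comm a d, real_inner_comm b c,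
      real_inner_comm b d, real_inner_comm c d]
    ring
  -- Polarisation of the quartic: the signed sum of the eight powers `(a ± b ± c ± d)⁴` is `8 · 4! =
  -- 192` times the product.
  have e : (fun ω => W a ω * W b ω * (W c ω * W d ω)) = fun ω => (1 / 192 : ℝ) *
      (((W a ω + 1 * W b ω + 1 * W c ω + 1 * W d ω) ^ 4
        - (W a ω + 1 * W b ω + 1 * W c ω + (-1) * W d ω) ^ 4)
      - ((W a ω + 1 * W b ω + (-1) * W c ω + 1 * W d ω) ^ 4
        - (W a ω + 1 * W b ω + (-1) * W c ω + (-1) * W d ω) ^ 4)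
      - (((W a ω + (-1) * W b ω + 1 * W c ω + 1 * W d ω) ^ 4
        - (W a ω + (-1) * W b ω + 1 * W c ω + (-1) * W d ω) ^ 4)
      - ((W a ω + (-1) * W b ω + (-1) * W c ω + 1 * W d ω) ^ 4
        - (W a ω + (-1) * W b ω + (-1) * W c ω + (-1) * W d ω) ^ 4))) := by
    ext ω; ring
  have i1 : ∀ s t, Integrable (fun ω => (W a ω + s * W b ω + t * W c ω + 1 * W d ω) ^ 4
        - (W a ω + s * W b ω + t * W c ω + (-1) * W d ω) ^ 4) P :=
    fun s t => (key _ _ _).2.sub (key _ _ _).2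
  have i2 : ∀ s, Integrable (fun ω => ((W a ω + s * W b ω + 1 * W c ω + 1 * W d ω) ^ 4
        - (W a ω + s * W b ω + 1 * W c ω + (-1) * W d ω) ^ 4)
      - ((W a ω + s * W b ω + (-1) * W c ω + 1 * W d ω) ^ 4
        - (W a ω + s * W b ω + (-1) * W c ω + (-1) * W d ω) ^ 4)) P :=
    fun s => (i1 _ _).sub (i1 _ _)
  constructor
  · rw [e]
    exact ((i2 _).sub (i2 _)).const_mul _
  · rw [e, integral_const_mul, integral_sub (i2 _) (i2 _), integral_sub (i1 _ _) (i1 _ _),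
      integral_sub (i1 _ _) (i1 _ _), integral_sub (key _ _ _).2 (key _ _ _).2,
      integral_sub (key _ _ _).2 (key _ _ _).2, integral_sub (key _ _ _).2 (key _ _ _).2,
      integral_sub (key _ _ _).2 (key _ _ _).2]
    simp only [(key _ _ _).1]
    ring

end Isonormal

/-! ### The moving average process and its admissibility -/

section MovingAverage

/-- The triangular covariance function `u ↦ (1 - |u|)₊`. -/
def triangle (u : ℝ) : ℝ := max (1 - |u|) 0

lemma triangle_nonneg (u : ℝ) : 0 ≤ triangle u := le_max_right _ _

lemma triangle_le_one (u : ℝ) : triangle u ≤ 1 :=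
  max_le (by linarith [abs_nonneg u]) zero_le_one

lemma triangle_zero : triangle 0 = 1 := by simp [triangle]

/-- A decorrelation rate must be strictly positive, while the triangle vanishes beyond `1`; an
exponential majorant serves as rate. -/
lemma triangle_le_exp {T u : ℝ} (h : T ≤ u) : triangle u ≤ Real.exp (1 - T) := by
  refine max_le ?_ (Real.exp_pos _).le
  have := Real.add_one_le_exp (1 - T)
  linarith [le_abs_self u]

lemma lipschitzWith_triangle : LipschitzWith 1 triangle := by
  refine LipschitzWith.of_dist_le_mul fun x y => ?_
  simp only [triangle, Real.dist_eq, NNReal.coe_one, one_mul]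
  refine (abs_max_sub_max_le_abs _ _ _).trans ?_
  rw [sub_sub_sub_cancel_left, abs_sub_comm x y]
  exact abs_abs_sub_abs_le _ _

/-- The Hilbert space carrying `r` independent white noises on the line. -/
abbrev WhiteNoiseSpace (r : ℕ) : Type :=
  Lp ℝ 2 ((volume : Measure ℝ).prod (Measure.count : Measure (Fin r)))

lemma measure_unitWindow_ne_top {r : ℕ} (t : ℝ) (i : Fin r) :
    ((volume : Measure ℝ).prod (Measure.count : Measure (Fin r))) (Icc t (t + 1) ×ˢ {i}) ≠ ∞ := by
  rw [Measure.prod_prod]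
  simp

/-- The indicator of the time window `[t, t + 1]` in the `i`-th noise. -/
noncomputable def unitWindow {r : ℕ} (t : ℝ) (i : Fin r) : WhiteNoiseSpace r :=
  indicatorConstLp 2 (s := Icc t (t + 1) ×ˢ {i}) (measurableSet_Icc.prod (measurableSet_singleton i))
    (measure_unitWindow_ne_top t i) (1 : ℝ)

lemma inner_unitWindow {r : ℕ} (s t : ℝ) (i j : Fin r) :
    inner ℝ (unitWindow s i) (unitWindow t j) = if i = j then triangle (t - s) else 0 := by
  rw [unitWindow, unitWindow, L2.real_inner_indicatorConstLp_one_indicatorConstLp_one _ _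
      (measure_unitWindow_ne_top s i) (measure_unitWindow_ne_top t j),
    prod_inter_prod, measureReal_prod_prod, Icc_inter_Icc]
  split_ifs with hij
  · subst hij
    rw [Real.volume_real_Icc, inter_self, triangle]
    have : (Measure.count : Measure (Fin r)).real {i} = 1 := by simp [Measure.real]
    rw [this, mul_one]
    congr 1
    change min (s + 1) (t + 1) - max s t = _
    rcases le_total s t with h | h
    · rw [min_eq_left (by linarith), max_eq_right h, abs_of_nonneg (by linarith)]; ring
    · rw [min_eq_right (by linarith), max_eq_left h, abs_of_nonpos (by linarith)]; ring
  · rw [singleton_inter_eq_empty.2 (by simpa using hij)]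
    simp

variable {Ω : Type} [MeasurableSpace Ω] {P : Measure Ω}

/-- A linear functional of finitely many values of `W` is `W` of one vector. Its law is therefore
determined by the Gram matrix, which yields both joint Gaussianity and stationarity. -/
lemma isonormal_map_dual {H : Type*} [NormedAddCommGroup H] [InnerProductSpace ℝ H]
    {W : H →ₗᵢ[ℝ] Lp ℝ 2 P} (hW : ∀ h, P.map (W h) = gaussianReal 0 (‖h‖ ^ 2).toNNReal)
    {ι κ : Type*} [Fintype ι] [Fintype κ] [DecidableEq ι] [DecidableEq κ] (g : ι → κ → H)
    (L : StrongDual ℝ (ι → κ → ℝ)) :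
    (P.map (fun ω k i => W (g k i) ω)).map L = gaussianReal 0
      (‖∑ p : ι × κ, L (Pi.single p.1 (Pi.single p.2 1)) • g p.1 p.2‖ ^ 2).toNNReal := by
  have hm : AEMeasurable (fun ω k i => W (g k i) ω) P :=
    aemeasurable_pi_iff.2 fun k => aemeasurable_pi_iff.2 fun i => isonormal_aemeasurable (g k i)
  rw [AEMeasurable.map_map_of_aemeasurable (by fun_prop) hm, ← hW]
  refine Measure.map_congr ?_
  have h2 : ∀ᵐ ω ∂P, ∀ p ∈ (Finset.univ : Finset (ι × κ)),
      W (L (Pi.single p.1 (Pi.single p.2 1)) • g p.1 p.2) ω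
        = L (Pi.single p.1 (Pi.single p.2 1)) * W (g p.1 p.2) ω :=
    (Finset.eventually_all _).2 fun p _ => isonormal_smul _ _
  filter_upwards [isonormal_sum (W := W) Finset.univ
    (fun p : ι × κ => L (Pi.single p.1 (Pi.single p.2 1)) • g p.1 p.2), h2] with ω h1 h2
  rw [h1, Finset.sum_congr rfl h2, Function.comp_apply]
  have hx : (fun k i => W (g k i) ω)
      = ∑ p : ι × κ, W (g p.1 p.2) ω • Pi.single p.1 (Pi.single p.2 (1 : ℝ)) := by
    ext k i
    rw [Fintype.sum_prod_type]
    simp [Finset.sum_apply, Pi.single_apply, ite_apply]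
  rw [hx, map_sum]
  exact Finset.sum_congr rfl fun p _ => by rw [map_smul, smul_eq_mul, mul_comm]

lemma isonormal_hasGaussianLaw_pi {H : Type*} [NormedAddCommGroup H] [InnerProductSpace ℝ H]
    {W : H →ₗᵢ[ℝ] Lp ℝ 2 P} (hW : ∀ h, P.map (W h) = gaussianReal 0 (‖h‖ ^ 2).toNNReal)
    {ι κ : Type*} [Fintype ι] [Fintype κ] (g : ι → κ → H) :
    HasGaussianLaw (fun ω k i => W (g k i) ω) P := by
  classical
  exact ⟨isGaussian_of_map_eq_gaussianReal fun L => ⟨_, _, isonormal_map_dual hW g L⟩⟩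

variable {r : ℕ} {W : WhiteNoiseSpace r →ₗᵢ[ℝ] Lp ℝ 2 P}

/-- The moving averages `X_t(i) = B_{t+1}(i) - B_t(i)` of `r` independent white noises. -/
noncomputable def movingAverage (W : WhiteNoiseSpace r →ₗᵢ[ℝ] Lp ℝ 2 P) (t : ℝ) (ω : Ω) :
    Fin r → ℝ :=
  fun i => W (unitWindow t i) ω

lemma isStrictlyStationary_movingAverage [IsProbabilityMeasure P]
    (hW : ∀ h, P.map (W h) = gaussianReal 0 (‖h‖ ^ 2).toNNReal) :
    IsStrictlyStationary P (movingAverage W) := by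
  intro n t s _ _
  have h1 := (isonormal_hasGaussianLaw_pi hW
    (fun (k : Fin n) (i : Fin r) => unitWindow (t k + s) i)).isGaussian_map
  have h2 := (isonormal_hasGaussianLaw_pi hW
    (fun (k : Fin n) (i : Fin r) => unitWindow (t k) i)).isGaussian_map
  change P.map (fun ω k i => W (unitWindow (t k + s) i) ω)
    = P.map (fun ω k i => W (unitWindow (t k) i) ω)
  refine Measure.ext_of_charFunDual ?_
  ext L
  rw [charFunDual_eq_charFun_map_one, charFunDual_eq_charFun_map_one, isonormal_map_dual hW,
    isonormal_map_dual hW]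
  -- Only the variance of each linear functional matters, and the Gram matrix of the windows depends
  -- on time differences alone.
  suffices h : ∀ c : Fin n × Fin r → ℝ, ‖∑ p, c p • unitWindow (t p.1 + s) p.2‖ ^ 2
      = ‖∑ p, c p • unitWindow (t p.1) p.2‖ ^ 2 by rw [h]
  intro c
  simp only [← real_inner_self_eq_norm_sq, sum_inner, inner_sum, real_inner_smul_left,
    real_inner_smul_right, inner_unitWindow, add_sub_add_right_eq_sub]

lemma isGaussianProcess_movingAverage
    (hW : ∀ h, P.map (W h) = gaussianReal 0 (‖h‖ ^ 2).toNNReal) :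
    IsGaussianProcess (fun t : ℝ≥0 => movingAverage W t) P :=
  ⟨fun I => isonormal_hasGaussianLaw_pi hW (fun (t : I) (i : Fin r) => unitWindow (t.1 : ℝ) i)⟩

lemma laggedCov_movingAverage (hW : ∀ h, P.map (W h) = gaussianReal 0 (‖h‖ ^ 2).toNNReal) (u : ℝ)
    (i j : Fin r) : laggedCov P (movingAverage W) u i j = if i = j then triangle u else 0 := by
  simp only [laggedCov, Matrix.of_apply, movingAverage, isonormal_integral_mul,
    isonormal_integral hW, inner_unitWindow]
  simp

lemma memLp_movingAverage (hW : ∀ h, P.map (W h) = gaussianReal 0 (‖h‖ ^ 2).toNNReal) (t : ℝ) :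
    MemLp (movingAverage W t) 4 P := by
  have := (isonormal_hasGaussianLaw_pi hW (fun (_ : Fin 1) (i : Fin r) => unitWindow t i)).eval 0
  exact this.memLp (by simp)

lemma hasIntegrableDecorrelationRate_movingAverage
    (hW : ∀ h, P.map (W h) = gaussianReal 0 (‖h‖ ^ 2).toNNReal) :
    HasIntegrableDecorrelationRate P (movingAverage W) (fun T => 2 * Real.exp (1 - T)) where
  pos T _ := by positivity
  antitone a _ b _ hab := by
    simp only
    gcongr
  continuous := by fun_prop
  integrable := by
    have h := ((integrableOn_exp_neg_Ioi 1).const_mul (2 * Real.exp 1))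
    refine h.congr (ae_of_all _ fun T => ?_)
    simp only
    rw [mul_assoc, ← Real.exp_add, sub_eq_add_neg]
  decorrelation := by
    intro U V T _ _ _ _ _ _ _ hT G hG H hH
    have hc : ∀ s ∈ U, ∀ t ∈ V, ∀ i j : Fin r,
        0 ≤ inner ℝ (unitWindow s i) (unitWindow t j)
          ∧ inner ℝ (unitWindow s i) (unitWindow t j) ≤ 1
          ∧ inner ℝ (unitWindow s i) (unitWindow t j) ≤ Real.exp (1 - T) := by
      intro s hs t ht i j
      rw [inner_unitWindow]
      split_ifs
      · exact ⟨triangle_nonneg _, triangle_le_one _, triangle_le_exp (hT.1 ⟨s, hs, t, ht, rfl⟩)⟩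
      · exact ⟨le_rfl, zero_le_one, (Real.exp_pos _).le⟩
    have he := Real.exp_pos (1 - T)
    rcases hG with ⟨s, hs, i, rfl⟩ | ⟨s, hs, s', hs', i, i', rfl⟩ <;>
    rcases hH with ⟨t, ht, j, rfl⟩ | ⟨t, ht, t', ht', j, j', rfl⟩ <;>
    simp only [movingAverage]
    · rw [isonormal_integral_mul, isonormal_integral hW, zero_mul, sub_zero]
      obtain ⟨h1, -, h3⟩ := hc s hs t ht i j
      rw [abs_of_nonneg h1]
      linarith
    · simp only [← mul_assoc]
      rw [isonormal_integral_mul_mul hW, isonormal_integral hW, zero_mul, sub_zero, abs_zero]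
      positivity
    · rw [isonormal_integral_mul_mul hW, isonormal_integral hW, mul_zero, sub_zero, abs_zero]
      positivity
    -- Wick's formula cancels the product of means and leaves two cross pairings. Each is at most
    -- `exp (1 - T) * 1`, hence the factor `2` in the rate; odd moments vanish in the mixed cases.
    · rw [(isonormal_wick hW _ _ _ _).2, isonormal_integral_mul, isonormal_integral_mul]
      obtain ⟨a1, a2, a3⟩ := hc s hs t ht i j
      obtain ⟨b1, b2, b3⟩ := hc s' hs' t' ht' i' j'
      obtain ⟨c1, c2, c3⟩ := hc s hs t' ht' i j'
      obtain ⟨d1, d2, d3⟩ := hc s' hs' t ht i' j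
      rw [abs_of_nonneg (by nlinarith [mul_nonneg a1 b1, mul_nonneg c1 d1])]
      nlinarith [mul_le_mul a3 b2 b1 he.le, mul_le_mul c3 d2 d1 he.le]

lemma isAdmissibleProcess_movingAverage [IsProbabilityMeasure P]
    (hW : ∀ h, P.map (W h) = gaussianReal 0 (‖h‖ ^ 2).toNNReal) :
    IsAdmissibleProcess P (movingAverage W) (fun T => 2 * Real.exp (1 - T)) where
  stationary := isStrictlyStationary_movingAverage hW
  memLp t _ := memLp_movingAverage hW t
  locallyLipschitz i j := by
    simp only [laggedCov_movingAverage hW]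
    refine LocallyLipschitz.locallyLipschitzOn ?_
    split_ifs
    · exact lipschitzWith_triangle.locallyLipschitz
    · exact LocallyLipschitz.const 0
  decorrelation := hasIntegrableDecorrelationRate_movingAverage hW

end MovingAverage

/-! ### Sums of decaying quantities over the sampling grid -/

section Counting

/-- Monotone comparison with an integral at right endpoints, rescaled by `T = xΔ - B`. The condition
on `k₀` keeps the range of integration inside `(1, ∞)`, where `f` is integrable. -/
lemma sum_rate_le_integral {f : ℝ → ℝ} (hpos : ∀ T, 0 < T → 0 < f T)
    (hanti : AntitoneOn f (Ioi 0)) (hint : IntegrableOn f (Ioi 1)) {B Δ : ℝ} (hΔ : 0 < Δ)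
    {k₀ n : ℕ} (hk : k₀ ≤ n) (hk₀ : B + 1 < k₀ * Δ) :
    ∑ k ∈ Finset.Ico k₀ n, f (((k + 1 : ℕ) : ℝ) * Δ - B) ≤ (∫ T in Ioi (1 : ℝ), f T) / Δ := by
  have hanti' : AntitoneOn (fun x : ℝ => f (Δ * x - B)) (Icc (k₀ : ℝ) n) := by
    intro x hx y hy hxy
    have h1 : k₀ * Δ ≤ x * Δ := by gcongr; exact hx.1
    have h2 : x * Δ ≤ y * Δ := by gcongr
    refine hanti ?_ ?_ ?_
    · simp only [mem_Ioi]; nlinarith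
    · simp only [mem_Ioi]; nlinarith
    · nlinarith
  have h := hanti'.sum_le_integral_Ico hk
  rw [intervalIntegral.integral_comp_mul_sub _ hΔ.ne'] at h
  calc ∑ k ∈ Finset.Ico k₀ n, f (((k + 1 : ℕ) : ℝ) * Δ - B)
      = ∑ k ∈ Finset.Ico k₀ n, f (Δ * ((k + 1 : ℕ) : ℝ) - B) := by simp only [mul_comm]
    _ ≤ Δ⁻¹ • ∫ T in (Δ * k₀ - B)..(Δ * n - B), f T := h
    _ ≤ (∫ T in Ioi (1 : ℝ), f T) / Δ := by
        rw [smul_eq_mul, div_eq_inv_mul]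
        have hkn : (k₀ : ℝ) ≤ n := by exact_mod_cast hk
        rw [intervalIntegral.integral_of_le (by nlinarith)]
        refine mul_le_mul_of_nonneg_left ?_ (by positivity)
        refine setIntegral_mono_set hint ?_ ?_
        · filter_upwards [ae_restrict_mem measurableSet_Ioi] with T hT
          exact (hpos T (zero_lt_one.trans hT)).le
        · refine LE.le.eventuallyLE fun T hT => ?_
          simp only [mem_Ioc, mem_Ioi] at hT ⊢
          nlinarith [hT.1]

lemma sum_envelope_le {f : ℝ → ℝ} (hpos : ∀ T, 0 < T → 0 < f T)
    (hanti : AntitoneOn f (Ioi 0)) (hint : IntegrableOn f (Ioi 1)) {M B Δ : ℝ} (hM : 0 ≤ M)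
    (hB : 0 ≤ B) (hΔ : 0 < Δ) (hΔ1 : Δ ≤ 1) {φ : ℕ → ℝ} (hφM : ∀ k, φ k ≤ M)
    (hφf : ∀ k : ℕ, B + 2 < k * Δ → φ k ≤ f (k * Δ - B)) (N : ℕ) :
    ∑ k ∈ Finset.range N, φ k ≤ (M * (B + 4) + ∫ T in Ioi (1 : ℝ), f T) / Δ := by
  have hI : 0 ≤ ∫ T in Ioi (1 : ℝ), f T :=
    setIntegral_nonneg measurableSet_Ioi fun T hT => (hpos T (zero_lt_one.trans hT)).le
  -- `k₀` is the first index with `k₀ Δ > B + 2`. Since `Δ ≤ 1`, the `k₀ + 1` near terms occupy time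
  -- at most `B + 4`; the extra term is needed because the integral comparison starts at the right
  -- endpoint.
  set k₀ := ⌊(B + 2) / Δ⌋₊ + 1 with hk₀
  have hk₀l : B + 2 < k₀ * Δ := by
    have := Nat.lt_floor_add_one ((B + 2) / Δ)
    rw [div_lt_iff₀ hΔ] at this
    simpa [hk₀] using this
  have hk₀u : (k₀ : ℝ) * Δ ≤ B + 3 := by
    have := Nat.floor_le (show 0 ≤ (B + 2) / Δ by positivity)
    rw [le_div_iff₀ hΔ] at this
    rw [hk₀]; push_cast; linarith
  have hlow : ∀ n : ℕ, ∑ k ∈ Finset.range n, φ k ≤ n * M := fun n => by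
    refine (Finset.sum_le_sum fun k _ => hφM k).trans (by simp)
  rw [le_div_iff₀ hΔ]
  rcases le_total N (k₀ + 1) with h | h
  · have h1 : (N : ℝ) ≤ k₀ + 1 := by exact_mod_cast h
    have h2 : (N : ℝ) * Δ ≤ B + 4 := by nlinarith
    calc (∑ k ∈ Finset.range N, φ k) * Δ ≤ N * M * Δ := by gcongr; exact hlow N
      _ = M * (N * Δ) := by ring
      _ ≤ M * (B + 4) := by gcongr
      _ ≤ _ := by linarith
  · obtain ⟨n, rfl⟩ : ∃ n, N = n + 1 := ⟨N - 1, by lia⟩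
    have hn : k₀ ≤ n := by lia
    rw [← Finset.sum_range_add_sum_Ico _ h]
    have h1 : ∑ k ∈ Finset.Ico (k₀ + 1) (n + 1), φ k ≤ (∫ T in Ioi (1 : ℝ), f T) / Δ := by
      refine le_trans ?_ (sum_rate_le_integral hpos hanti hint hΔ hn (B := B) (by linarith))
      rw [← Finset.sum_Ico_add']
      refine Finset.sum_le_sum fun k hk => hφf _ ?_
      have : (k₀ : ℝ) ≤ ((k + 1 : ℕ) : ℝ) := by
        exact_mod_cast (Finset.mem_Ico.1 hk).1.trans (Nat.le_succ k)
      nlinarith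
    have h2 := hlow (k₀ + 1)
    push_cast at h2
    rw [le_div_iff₀ hΔ] at h1
    have h3 : ((k₀ : ℝ) + 1) * Δ ≤ B + 4 := by linarith
    have h4 : (∑ k ∈ Finset.range (k₀ + 1), φ k) * Δ ≤ M * (B + 4) := by
      calc (∑ k ∈ Finset.range (k₀ + 1), φ k) * Δ ≤ (k₀ + 1) * M * Δ := by gcongr
        _ = M * ((k₀ + 1) * Δ) := by ring
        _ ≤ M * (B + 4) := by gcongr
    rw [add_mul]; linarith

/-- Each distance from `a` occurs at most once on either side of `a`. -/
lemma sum_dist_le {φ : ℕ → ℝ} (hφ : ∀ k, 0 ≤ φ k) {N a : ℕ} (ha : a ∈ Finset.Icc 1 N) :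
    ∑ b ∈ Finset.Icc 1 N, φ (Nat.dist a b) ≤ 2 * ∑ k ∈ Finset.range N, φ k := by
  rw [Finset.mem_Icc] at ha
  rw [two_mul, ← Finset.sum_filter_add_sum_filter_not _ (fun b => b ≤ a)]
  refine add_le_add ?_ ?_
  · rw [← Finset.sum_image (g := fun b => Nat.dist a b) (f := φ)]
    · refine Finset.sum_le_sum_of_subset_of_nonneg (fun k hk => ?_) fun k _ _ => hφ k
      simp only [Finset.mem_image, Finset.mem_filter, Finset.mem_Icc, Nat.dist,
        Finset.mem_range] at hk ⊢
      lia
    · intro b hb c hc h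
      simp only [Finset.coe_filter, Finset.mem_Icc, mem_ofPred_eq, Nat.dist] at hb hc h
      lia
  · rw [← Finset.sum_image (g := fun b => Nat.dist a b) (f := φ)]
    · refine Finset.sum_le_sum_of_subset_of_nonneg (fun k hk => ?_) fun k _ _ => hφ k
      simp only [Finset.mem_image, Finset.mem_filter, Finset.mem_Icc, Nat.dist,
        Finset.mem_range] at hk ⊢
      lia
    · intro b hb c hc h
      simp only [Finset.coe_filter, Finset.mem_Icc, mem_ofPred_eq, Nat.dist] at hb hc h
      lia

/-- The bound `M` at distances up to `B + 2`, and `min M (f (x - B))` beyond. -/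
noncomputable def rateEnvelope (f : ℝ → ℝ) (M B x : ℝ) : ℝ :=
  if x ≤ B + 2 then M else min M (f (x - B))

lemma rateEnvelope_nonneg {f : ℝ → ℝ} (hpos : ∀ T, 0 < T → 0 < f T) {M B x : ℝ} (hM : 0 ≤ M) :
    0 ≤ rateEnvelope f M B x := by
  unfold rateEnvelope
  split_ifs with h
  · exact hM
  · exact le_min hM (hpos _ (by linarith)).le

/-- A double sum of a quantity that decays at an integrable rate in the time lag. -/
lemma sum_sum_rateEnvelope_le {f : ℝ → ℝ} (hpos : ∀ T, 0 < T → 0 < f T)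
    (hanti : AntitoneOn f (Ioi 0)) (hint : IntegrableOn f (Ioi 1)) {M B Δ : ℝ} (hM : 0 ≤ M)
    (hB : 0 ≤ B) (hΔ : 0 < Δ) (hΔ1 : Δ ≤ 1) (N : ℕ) :
    ∑ a ∈ Finset.Icc 1 N, ∑ b ∈ Finset.Icc 1 N, rateEnvelope f M B (Nat.dist a b * Δ)
      ≤ N * (2 * (M * (B + 4) + ∫ T in Ioi (1 : ℝ), f T) / Δ) := by
  have h := sum_envelope_le hpos hanti hint hM hB hΔ hΔ1
    (φ := fun k => rateEnvelope f M B (k * Δ)) (fun k => by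
      unfold rateEnvelope; split_ifs
      · exact le_rfl
      · exact min_le_left _ _) (fun k hk => by
      simp only [rateEnvelope, if_neg hk.not_ge]
      exact min_le_right _ _) N
  calc _ ≤ ∑ a ∈ Finset.Icc 1 N, 2 * ∑ k ∈ Finset.range N, rateEnvelope f M B (k * Δ) :=
        Finset.sum_le_sum fun a ha =>
          sum_dist_le (φ := fun k => rateEnvelope f M B (k * Δ))
            (fun k => rateEnvelope_nonneg hpos hM) ha
    _ = N * (2 * ∑ k ∈ Finset.range N, rateEnvelope f M B (k * Δ)) := by simp
    _ ≤ N * (2 * ((M * (B + 4) + ∫ T in Ioi (1 : ℝ), f T) / Δ)) := by gcongr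
    _ = _ := by ring

end Counting

/-! ### Entries of the empirical covariance and their integrability -/

section Entries

lemma empiricalCov_apply {Ω : Type*} {r : ℕ} (X : ℝ → Ω → Fin r → ℝ) (N : ℕ) (Δ u : ℝ) (ω : Ω)
    (i j : Fin r) : empiricalCov X N Δ u ω i j
      = 1 / (N : ℝ) * ∑ n ∈ Finset.Icc 1 N, X (n * Δ) ω i * X ((n + round (u / Δ)) * Δ) ω j
        - shiftedMean X N Δ 0 ω i * shiftedMean X N Δ (round (u / Δ)) ω j := by
  simp [empiricalCov, Matrix.sub_apply, Matrix.smul_apply, Matrix.sum_apply, Matrix.vecMulVec_apply]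

variable {Ω : Type*} [MeasurableSpace Ω] {P : Measure Ω} {r : ℕ}

lemma MeasureTheory.MemLp.mul_of_four {f g : Ω → ℝ} (hf : MemLp f 4 P) (hg : MemLp g 4 P) :
    MemLp (fun ω => f ω * g ω) 2 P := by
  have : ENNReal.HolderTriple 4 4 2 := ⟨by
    rw [← ENNReal.toReal_eq_toReal_iff' (by simp) (by simp), ENNReal.toReal_add (by simp) (by simp)]
    norm_num⟩
  exact hg.mul hf

lemma MeasureTheory.MemLp.eval_four {X : Ω → Fin r → ℝ} (h : MemLp X 4 P) (i : Fin r) :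
    MemLp (fun ω => X ω i) 4 P :=
  h.mono ((measurable_pi_apply i).aemeasurable.comp_aemeasurable
    h.aestronglyMeasurable.aemeasurable).aestronglyMeasurable
    (ae_of_all _ fun ω => norm_le_pi_norm (X ω) i)

lemma eLpNorm_two_eq_sqrt {g : Ω → ℝ} (hg : MemLp g 2 P) :
    eLpNorm g 2 P = ENNReal.ofReal (√(∫ ω, g ω ^ 2 ∂P)) := by
  have h := sq_norm_Lp_eq_integral (hg.toLp g)
  have h2 : ∫ ω, (hg.toLp g) ω ^ 2 ∂P = ∫ ω, g ω ^ 2 ∂P :=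
    integral_congr_ae (hg.coeFn_toLp.mono fun ω hω => by simp only [hω])
  rw [← h2, ← h, Real.sqrt_sq (norm_nonneg _), Lp.norm_toLp, ENNReal.ofReal_toReal hg.2.ne]

lemma eLpNorm_entry_le_covError (X : ℝ → Ω → Fin r → ℝ) (N : ℕ) (Δ u : ℝ) (i j : Fin r) :
    eLpNorm (fun ω => empiricalCov X N Δ u ω i j - laggedCov P X u i j) 2 P
      ≤ covError P X N Δ u := by
  refine eLpNorm_mono fun ω => ?_
  have h1 := norm_le_pi_norm (Matrix.of.symm (empiricalCov X N Δ u ω - laggedCov P X u)) i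
  have h2 := norm_le_pi_norm (Matrix.of.symm (empiricalCov X N Δ u ω - laggedCov P X u) i) j
  exact h2.trans h1

lemma memLp_shiftedMean {p : ℝ≥0∞} {X : ℝ → Ω → Fin r → ℝ} {N : ℕ} {Δ : ℝ} {κ : ℤ} {j : Fin r}
    (h : ∀ n ∈ Finset.Icc 1 N, MemLp (fun ω => X ((n + κ) * Δ) ω j) p P) :
    MemLp (fun ω => shiftedMean X N Δ κ ω j) p P := by
  have : (fun ω => shiftedMean X N Δ κ ω j)
      = fun ω => 1 / (N : ℝ) * ∑ n ∈ Finset.Icc 1 N, X ((n + κ) * Δ) ω j := by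
    ext ω; simp [shiftedMean, Finset.sum_apply]
  rw [this]
  exact (memLp_finsetSum _ h).const_mul _

lemma memLp_empiricalCov_apply {X : ℝ → Ω → Fin r → ℝ} {N : ℕ} {Δ u : ℝ} {i j : Fin r}
    (h0 : ∀ n ∈ Finset.Icc 1 N, MemLp (fun ω => X (n * Δ) ω i) 4 P)
    (h1 : ∀ n ∈ Finset.Icc 1 N, MemLp (fun ω => X ((n + round (u / Δ)) * Δ) ω j) 4 P) :
    MemLp (fun ω => empiricalCov X N Δ u ω i j) 2 P := by
  simp only [empiricalCov_apply]
  refine MemLp.sub ((memLp_finsetSum _ fun n hn => (h0 n hn).mul_of_four (h1 n hn)).const_mul _) ?_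
  exact (memLp_shiftedMean fun n hn => by simpa using h0 n hn).mul_of_four (memLp_shiftedMean h1)

end Entries

/-! ### Bias and fluctuations for the moving average -/

section LowerBound

variable {Ω : Type} [MeasurableSpace Ω] {P : Measure Ω} {r : ℕ}
  {W : WhiteNoiseSpace r →ₗᵢ[ℝ] Lp ℝ 2 P}

/-- The empirical mean is the image of a single averaged window, hence itself Gaussian with moments
given by that vector's norm. -/
lemma shiftedMean_movingAverage (N : ℕ) (Δ : ℝ) (κ : ℤ) (i : Fin r) :
    W ((1 / (N : ℝ)) • ∑ n ∈ Finset.Icc 1 N, unitWindow ((n + κ) * Δ) i)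
      =ᵐ[P] fun ω => shiftedMean (movingAverage W) N Δ κ ω i := by
  filter_upwards [isonormal_smul (W := W) (1 / (N : ℝ))
    (∑ n ∈ Finset.Icc 1 N, unitWindow ((n + κ) * Δ) i),
    isonormal_sum (W := W) (Finset.Icc 1 N) (fun n => unitWindow ((n + κ) * Δ) i)] with ω h1 h2
  rw [h1, h2]
  simp [shiftedMean, Finset.sum_apply, movingAverage]

lemma memLp_movingAverage_apply (hW : ∀ h, P.map (W h) = gaussianReal 0 (‖h‖ ^ 2).toNNReal)
    (t : ℝ) (i : Fin r) : MemLp (fun ω => movingAverage W t ω i) 4 P :=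
  (memLp_movingAverage hW t).eval_four i

/-- The bias of the estimator between two grid points. -/
lemma bias_le_covError [IsProbabilityMeasure P]
    (hW : ∀ h, P.map (W h) = gaussianReal 0 (‖h‖ ^ 2).toNNReal) (i : Fin r)
    {N : ℕ} (hN : 1 ≤ N) {Δ : ℝ} (hΔ : 0 < Δ) (hΔ1 : Δ ≤ 1) :
    ENNReal.ofReal (Δ / 4) ≤ covError P (movingAverage W) N Δ (3 / 4 * Δ) := by
  -- The lag `3Δ / 4` is rounded up to `Δ`, where the covariance is smaller by `Δ / 4`.
  have hround : round (3 / 4 * Δ / Δ) = 1 := by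
    rw [mul_div_assoc, div_self hΔ.ne', round_eq, Int.floor_eq_iff]; norm_num
  refine le_trans ?_ (eLpNorm_entry_le_covError _ N Δ _ i i)
  have hm := memLp_empiricalCov_apply (X := movingAverage W) (N := N) (Δ := Δ) (u := 3 / 4 * Δ)
    (i := i) (j := i) (fun n _ => memLp_movingAverage_apply hW _ i)
    (fun n _ => memLp_movingAverage_apply hW _ i)
  set K := laggedCov P (movingAverage W) (3 / 4 * Δ) i i with hK
  have hKv : K = 1 - 3 / 4 * Δ := by
    rw [hK, laggedCov_movingAverage hW, if_pos rfl, triangle, abs_of_pos (by positivity),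
      max_eq_left (by linarith)]
  have hmean : ∫ ω, (empiricalCov (movingAverage W) N Δ (3 / 4 * Δ) ω i i - K) ∂P ≤ -(Δ / 4) := by
    rw [integral_sub (hm.integrable (by norm_num)) (integrable_const _)]
    simp only [empiricalCov_apply, hround]
    have i1 : ∀ n ∈ Finset.Icc 1 N, Integrable (fun ω => movingAverage W (n * Δ) ω i
        * movingAverage W ((n + ((1 : ℤ) : ℝ)) * Δ) ω i) P := fun n _ =>
      ((memLp_movingAverage_apply hW _ i).mul_of_four
        (memLp_movingAverage_apply hW _ i)).integrable (by norm_num)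
    have i2 : Integrable (fun ω => shiftedMean (movingAverage W) N Δ 0 ω i
        * shiftedMean (movingAverage W) N Δ 1 ω i) P :=
      ((memLp_shiftedMean fun n _ => memLp_movingAverage_apply hW _ i).mul_of_four
        (memLp_shiftedMean fun n _ => memLp_movingAverage_apply hW _ i)).integrable (by norm_num)
    rw [integral_sub ((integrable_finsetSum _ i1).const_mul _) i2, integral_const_mul,
      integral_finsetSum _ i1]
    have e1 : ∀ n ∈ Finset.Icc 1 N, ∫ ω, movingAverage W (n * Δ) ω i
        * movingAverage W ((n + ((1 : ℤ) : ℝ)) * Δ) ω i ∂P = 1 - Δ := fun n _ => by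
      simp only [movingAverage, isonormal_integral_mul, inner_unitWindow, if_true]
      rw [triangle, show ((n : ℝ) + ((1 : ℤ) : ℝ)) * Δ - n * Δ = Δ by push_cast; ring,
        abs_of_pos hΔ, max_eq_left (by linarith)]
    -- Subtracting the product of means can only lower the expectation further, so it cannot
    -- compensate the negative bias.
    have e2 : 0 ≤ ∫ ω, shiftedMean (movingAverage W) N Δ 0 ω i
        * shiftedMean (movingAverage W) N Δ 1 ω i ∂P := by
      have hae : ∀ᵐ ω ∂P, shiftedMean (movingAverage W) N Δ 0 ω i
          * shiftedMean (movingAverage W) N Δ 1 ω i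
          = W ((1 / (N : ℝ)) • ∑ n ∈ Finset.Icc 1 N, unitWindow ((n + ((0 : ℤ) : ℝ)) * Δ) i) ω
          * W ((1 / (N : ℝ)) • ∑ n ∈ Finset.Icc 1 N, unitWindow ((n + ((1 : ℤ) : ℝ)) * Δ) i) ω := by
        filter_upwards [shiftedMean_movingAverage (W := W) N Δ 0 i,
          shiftedMean_movingAverage (W := W) N Δ 1 i] with ω h1 h2
        rw [h1, h2]
      rw [integral_congr_ae hae, isonormal_integral_mul, real_inner_smul_left, real_inner_smul_right, sum_inner]
      refine mul_nonneg (by positivity) (mul_nonneg (by positivity)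
        (Finset.sum_nonneg fun n _ => ?_))
      rw [inner_sum]
      refine Finset.sum_nonneg fun m _ => ?_
      rw [inner_unitWindow, if_pos rfl]
      exact triangle_nonneg _
    rw [Finset.sum_congr rfl e1]
    have hN' : (N : ℝ) ≠ 0 := by positivity
    simp only [Finset.sum_const, Nat.card_Icc, add_tsub_cancel_right, nsmul_eq_mul, integral_const,
      probReal_univ, smul_eq_mul, one_mul]
    rw [← mul_assoc, one_div, inv_mul_cancel₀ hN', hKv]
    linarith
  have hms : MemLp (fun ω => empiricalCov (movingAverage W) N Δ (3 / 4 * Δ) ω i i - K) 2 P :=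
    hm.sub (memLp_const _)
  calc ENNReal.ofReal (Δ / 4)
      ≤ ‖∫ ω, (empiricalCov (movingAverage W) N Δ (3 / 4 * Δ) ω i i - K) ∂P‖ₑ := by
        rw [← ofReal_norm]
        refine ENNReal.ofReal_le_ofReal ?_
        rw [Real.norm_eq_abs, abs_of_nonpos (by linarith)]
        linarith
    _ ≤ eLpNorm (fun ω => empiricalCov (movingAverage W) N Δ (3 / 4 * Δ) ω i i - K) 1 P := by
        rw [eLpNorm_one_eq_lintegral_enorm]
        exact enorm_integral_le_lintegral_enorm _
    _ ≤ _ := eLpNorm_le_eLpNorm_of_exponent_le (by norm_num) hms.1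

lemma sum_sum_triangle_le {N : ℕ} {Δ : ℝ} (hΔ : 0 < Δ) (hΔ1 : Δ ≤ 1) :
    ∑ a ∈ Finset.Icc 1 N, ∑ b ∈ Finset.Icc 1 N, triangle (b * Δ - a * Δ) ≤ N * (12 / Δ) := by
  have h := sum_sum_rateEnvelope_le (f := fun T => 2 * Real.exp (1 - T)) (M := 1) (B := 0)
    (fun T _ => by positivity) (fun a _ b _ hab => by simp only; gcongr)
    (by
      refine ((integrableOn_exp_neg_Ioi 1).const_mul (2 * Real.exp 1)).congr
        (ae_of_all _ fun T => ?_)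
      simp only
      rw [mul_assoc, ← Real.exp_add, sub_eq_add_neg]) zero_le_one le_rfl hΔ hΔ1 N
  have hint : ∫ T in Ioi (1 : ℝ), 2 * Real.exp (1 - T) = 2 := by
    have : ∀ T : ℝ, 2 * Real.exp (1 - T) = 2 * Real.exp 1 * Real.exp (-T) := fun T => by
      rw [mul_assoc, ← Real.exp_add, sub_eq_add_neg]
    simp only [this]
    rw [integral_const_mul, integral_exp_neg_Ioi, mul_assoc, ← Real.exp_add]
    simp
  rw [hint] at h
  -- The constant is `12 = 2 * (1 * 4 + 2)`, from `M = 1`, `B = 0` and the integral `2`.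
  refine le_trans (Finset.sum_le_sum fun a _ => Finset.sum_le_sum fun b _ => ?_)
    (h.trans (le_of_eq (by ring)))
  have habs : |(b : ℝ) * Δ - a * Δ| = Nat.dist a b * Δ := by
    rw [← sub_mul, abs_mul, abs_of_pos hΔ]
    congr 1
    rcases le_total a b with h | h
    · rw [Nat.dist_eq_sub_of_le h, Nat.cast_sub h, abs_of_nonneg (by simpa using h)]
    · rw [Nat.dist_eq_sub_of_le_right h, Nat.cast_sub h, abs_of_nonpos (by simpa using h)]; ring
  rw [rateEnvelope]
  split_ifs with hle
  · exact triangle_le_one _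
  · rw [triangle, habs, max_eq_right (by linarith)]
    exact le_min zero_le_one (by positivity)

/-- Keep only pairs at time distance at most `1 / 2`, where the squared triangle is at least `1 /
4`. At least `N / 2` starting points have at least `1 / (2Δ)` such partners each, to the right and
within range. -/
lemma le_sum_sum_triangle_sq {N : ℕ} {Δ : ℝ} (hΔ : 0 < Δ) (hN : 1 ≤ N * Δ) :
    N / (16 * Δ)
      ≤ ∑ a ∈ Finset.Icc 1 N, ∑ b ∈ Finset.Icc 1 N, triangle (b * Δ - a * Δ) ^ 2 := by
  set D := ⌊1 / (2 * Δ)⌋₊ with hD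
  have hDu : D * Δ ≤ 1 / 2 := by
    have := Nat.floor_le (show 0 ≤ 1 / (2 * Δ) by positivity)
    rw [le_div_iff₀ (by positivity)] at this
    linarith
  have hDl : 1 / (2 * Δ) ≤ D + 1 := (Nat.lt_floor_add_one _).le
  have hDN : (D : ℝ) ≤ N / 2 := by
    have : (D : ℝ) * Δ ≤ N / 2 * Δ := by linarith
    exact le_of_mul_le_mul_right this hΔ
  have hDN' : D ≤ N := by
    have : (D : ℝ) ≤ N := by linarith [(Nat.cast_nonneg N : (0 : ℝ) ≤ N)]
    exact_mod_cast this
  calc (N : ℝ) / (16 * Δ) = (N / 2) * ((1 / (2 * Δ)) * (1 / 4)) := by field_simp; ring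
    _ ≤ (N - D : ℝ) * ((D + 1) * (1 / 4)) := by
        gcongr ?_ * (?_ * _) <;> linarith
    _ = ∑ a ∈ Finset.Icc 1 (N - D), ∑ b ∈ Finset.Icc a (a + D), (1 / 4 : ℝ) := by
        have : ∀ a ∈ Finset.Icc 1 (N - D), ∑ b ∈ Finset.Icc a (a + D), (1 / 4 : ℝ)
            = (D + 1) * (1 / 4) := fun a _ => by
          rw [Finset.sum_const, Nat.card_Icc, nsmul_eq_mul, show a + D + 1 - a = D + 1 by lia]
          push_cast; ring
        rw [Finset.sum_congr rfl this, Finset.sum_const, Nat.card_Icc, nsmul_eq_mul,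
          add_tsub_cancel_right, Nat.cast_sub hDN']
    _ ≤ ∑ a ∈ Finset.Icc 1 (N - D), ∑ b ∈ Finset.Icc a (a + D), triangle (b * Δ - a * Δ) ^ 2 := by
        refine Finset.sum_le_sum fun a _ => Finset.sum_le_sum fun b hb => ?_
        rw [Finset.mem_Icc] at hb
        have h1 : (a : ℝ) ≤ b := by exact_mod_cast hb.1
        have h2 : (b : ℝ) ≤ a + D := by exact_mod_cast hb.2
        have h3 : 1 / 2 ≤ triangle (b * Δ - a * Δ) := by
          refine le_trans ?_ (le_max_left _ _)
          rw [abs_of_nonneg (by nlinarith)]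
          nlinarith
        nlinarith
    _ ≤ ∑ a ∈ Finset.Icc 1 (N - D), ∑ b ∈ Finset.Icc 1 N, triangle (b * Δ - a * Δ) ^ 2 := by
        refine Finset.sum_le_sum fun a ha => Finset.sum_le_sum_of_subset_of_nonneg
          (fun b hb => ?_) fun _ _ _ => sq_nonneg _
        rw [Finset.mem_Icc] at ha hb ⊢
        lia
    _ ≤ _ := by
        refine Finset.sum_le_sum_of_subset_of_nonneg
          (fun b hb => ?_) fun _ _ _ => Finset.sum_nonneg fun _ _ => sq_nonneg _
        rw [Finset.mem_Icc] at hb ⊢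
        lia

/-- The fluctuations of the estimator at lag `0`. -/
lemma fluctuation_le_covError [IsProbabilityMeasure P]
    (hW : ∀ h, P.map (W h) = gaussianReal 0 (‖h‖ ^ 2).toNNReal)
    (i : Fin r) {N : ℕ} {Δ : ℝ} (hΔ : 0 < Δ) (hΔ1 : Δ ≤ 1) (hN : 20000 ≤ N * Δ) :
    ENNReal.ofReal (√(1 / (32 * (N * Δ)))) ≤ covError P (movingAverage W) N Δ 0 := by
  have hN0 : (0 : ℝ) < N := by
    by_contra h
    have : (N : ℝ) = 0 := le_antisymm (not_lt.1 h) (Nat.cast_nonneg N)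
    rw [this] at hN; linarith
  refine le_trans ?_ (eLpNorm_entry_le_covError _ N Δ _ i i)
  have hm := memLp_empiricalCov_apply (X := movingAverage W) (N := N) (Δ := Δ) (u := 0)
    (i := i) (j := i) (fun n _ => memLp_movingAverage_apply hW _ i)
    (fun n _ => memLp_movingAverage_apply hW _ i)
  rw [laggedCov_movingAverage hW, if_pos rfl, triangle_zero]
  have hms : MemLp (fun ω => empiricalCov (movingAverage W) N Δ 0 ω i i - 1) 2 P :=
    hm.sub (memLp_const _)
  rw [eLpNorm_two_eq_sqrt hms]
  refine ENNReal.ofReal_le_ofReal (Real.sqrt_le_sqrt ?_)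
  set x : ℕ → Ω → ℝ := fun n ω => movingAverage W (n * Δ) ω i with hx
  set m : Ω → ℝ := fun ω => shiftedMean (movingAverage W) N Δ 0 ω i with hmdef
  set g := (1 / (N : ℝ)) • ∑ n ∈ Finset.Icc 1 N, unitWindow (((n : ℝ) + ((0 : ℤ) : ℝ)) * Δ) i
    with hg
  set V : Ω → ℝ := fun ω => 1 / (N : ℝ) * ∑ n ∈ Finset.Icc 1 N, (x n ω * x n ω - 1) with hV
  -- The error is the average of the centred squares minus the squared empirical mean. The former
  -- has second moment of order `1 / (NΔ)`, the latter only `1 / (NΔ)²`.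
  have hentry : ∀ ω, empiricalCov (movingAverage W) N Δ 0 ω i i - 1 = V ω - m ω ^ 2 := by
    intro ω
    rw [empiricalCov_apply]
    simp only [zero_div, round_zero, Int.cast_zero, add_zero, hV, Finset.sum_sub_distrib, hx, hmdef,
      Finset.sum_const, Nat.card_Icc, add_tsub_cancel_right, nsmul_eq_mul, mul_one]
    rw [mul_sub, one_div, inv_mul_cancel₀ hN0.ne']
    ring
  have hxL : ∀ n, MemLp (fun ω => x n ω * x n ω - 1) 2 P := fun n =>
    ((memLp_movingAverage_apply hW _ i).mul_of_four (memLp_movingAverage_apply hW _ i)).sub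
      (memLp_const _)
  have hVL : MemLp V 2 P := (memLp_finsetSum _ fun n _ => hxL n).const_mul _
  have hmae := shiftedMean_movingAverage (W := W) (P := P) N Δ 0 i
  have hm4 : ∫ ω, m ω ^ 4 ∂P = 3 * inner ℝ g g ^ 2 := by
    rw [← isonormal_integral_pow_four hW]
    exact integral_congr_ae (hmae.mono fun ω hω => by simp only [hmdef, ← hω, hg])
  have hm4i : Integrable (fun ω => m ω ^ 4) P :=
    (isonormal_integrable_pow hW g 4).congr
      (hmae.mono fun ω hω => by simp only [hmdef, ← hω, hg])
  have hgg : inner ℝ g g ≤ 12 / (N * Δ) := by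
    rw [hg, real_inner_smul_left, real_inner_smul_right, sum_inner]
    simp only [inner_sum, inner_unitWindow, if_true, Int.cast_zero, add_zero]
    calc 1 / (N : ℝ) * (1 / (N : ℝ) * ∑ a ∈ Finset.Icc 1 N, ∑ b ∈ Finset.Icc 1 N,
            triangle (b * Δ - a * Δ)) ≤ 1 / (N : ℝ) * (1 / (N : ℝ) * (N * (12 / Δ))) := by
          gcongr; exact sum_sum_triangle_le hΔ hΔ1
      _ = _ := by field_simp
  have hcov : ∀ a b : ℕ, Integrable (fun ω => (x a ω * x a ω - 1) * (x b ω * x b ω - 1)) P ∧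
      ∫ ω, (x a ω * x a ω - 1) * (x b ω * x b ω - 1) ∂P = 2 * triangle (b * Δ - a * Δ) ^ 2 := by
    intro a b
    refine ⟨(hxL a).integrable_mul (hxL b), ?_⟩
    have w := isonormal_wick hW (unitWindow (a * Δ) i) (unitWindow (a * Δ) i)
      (unitWindow (b * Δ) i) (unitWindow (b * Δ) i)
    have j : ∀ n : ℕ, Integrable (fun ω => x n ω * x n ω) P := fun n =>
      ((memLp_movingAverage_apply hW _ i).mul_of_four
        (memLp_movingAverage_apply hW _ i)).integrable (by norm_num)
    have w1 : Integrable (fun ω => x a ω * x a ω * (x b ω * x b ω)) P := w.1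
    have e : (fun ω => (x a ω * x a ω - 1) * (x b ω * x b ω - 1))
        = fun ω => x a ω * x a ω * (x b ω * x b ω) - x a ω * x a ω - x b ω * x b ω + 1 := by
      ext ω; ring
    have w2 : ∫ ω, x a ω * x a ω * (x b ω * x b ω) ∂P = 1 + 2 * triangle (b * Δ - a * Δ) ^ 2 := by
      refine w.2.trans ?_
      simp only [inner_unitWindow, if_true, sub_self, triangle_zero]
      ring
    have w3 : ∀ n : ℕ, ∫ ω, x n ω * x n ω ∂P = 1 := fun n => by
      simp only [hx, movingAverage, isonormal_integral_mul, inner_unitWindow, if_true, sub_self,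
        triangle_zero]
    have w4 : Integrable (fun ω => x a ω * x a ω * (x b ω * x b ω) - x a ω * x a ω) P :=
      w1.sub (j a)
    have w5 : Integrable (fun ω => x a ω * x a ω * (x b ω * x b ω) - x a ω * x a ω
      - x b ω * x b ω) P := w4.sub (j b)
    rw [e, integral_add w5 (integrable_const _), integral_sub w4 (j b), integral_sub w1 (j a), w2,
      w3, w3]
    simp
  have hV2 : 1 / (8 * (N * Δ)) ≤ ∫ ω, V ω ^ 2 ∂P := by
    have e : (fun ω => V ω ^ 2) = fun ω => (1 / (N : ℝ)) ^ 2 * ∑ a ∈ Finset.Icc 1 N,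
        ∑ b ∈ Finset.Icc 1 N, (x a ω * x a ω - 1) * (x b ω * x b ω - 1) := by
      ext ω
      simp only [hV]
      rw [mul_pow, sq (∑ n ∈ Finset.Icc 1 N, (x n ω * x n ω - 1)), Finset.sum_mul_sum]
    rw [e, integral_const_mul, integral_finsetSum _ fun a _ =>
      integrable_finsetSum _ fun b _ => (hcov a b).1]
    have e2 : ∀ a ∈ Finset.Icc 1 N, ∫ ω, ∑ b ∈ Finset.Icc 1 N,
        (x a ω * x a ω - 1) * (x b ω * x b ω - 1) ∂P
        = 2 * ∑ b ∈ Finset.Icc 1 N, triangle (b * Δ - a * Δ) ^ 2 := fun a _ => by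
      rw [integral_finsetSum _ fun b _ => (hcov a b).1, Finset.mul_sum]
      exact Finset.sum_congr rfl fun b _ => (hcov a b).2
    rw [Finset.sum_congr rfl e2, ← Finset.mul_sum]
    have := le_sum_sum_triangle_sq hΔ (N := N) (by linarith)
    calc 1 / (8 * (N * Δ)) = (1 / (N : ℝ)) ^ 2 * (2 * (N / (16 * Δ))) := by field_simp; norm_num
      _ ≤ _ := by gcongr
  have hfin : ∫ ω, V ω ^ 2 ∂P ≤
      ∫ ω, (2 * (empiricalCov (movingAverage W) N Δ 0 ω i i - 1) ^ 2 + 2 * m ω ^ 4) ∂P := by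
    refine integral_mono hVL.integrable_sq
      ((hms.integrable_sq.const_mul 2).add (hm4i.const_mul 2)) fun ω => ?_
    simp only [hentry]
    nlinarith [sq_nonneg (V ω - 2 * m ω ^ 2)]
  rw [integral_add (hms.integrable_sq.const_mul 2) (hm4i.const_mul 2), integral_const_mul,
    integral_const_mul, hm4] at hfin
  have hgg2 : inner ℝ g g ^ 2 ≤ (12 / (N * Δ)) ^ 2 := by
    gcongr
    exact real_inner_self_nonneg
  -- This needs `NΔ ≥ 3 * 144 * 32 = 13824`, which explains the threshold `20000`.
  have hsmall : 3 * (12 / (N * Δ)) ^ 2 ≤ 1 / (32 * (N * Δ)) := by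
    rw [div_pow, ← mul_div_assoc, div_le_div_iff₀ (by positivity) (by positivity)]
    nlinarith
  have hrel : 1 / (8 * (N * Δ)) = 4 * (1 / (32 * (N * Δ))) := by field_simp; norm_num
  linarith

end LowerBound

/-! ### Balancing bias against fluctuations -/

section LowerBound

lemma cast_eq_rpow_third_pow (N : ℕ) : ((N : ℝ) ^ (1 / 3 : ℝ)) ^ 3 = N := by
  rw [← Real.rpow_natCast, ← Real.rpow_mul (Nat.cast_nonneg N)]
  norm_num

/-- No adaptive scheme estimates the covariances of the moving average process at a uniform speed
better than `N ^ (-1/3)`. -/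
theorem eventually_le_covError_movingAverage {Ω : Type} [MeasurableSpace Ω] {P : Measure Ω}
    [IsProbabilityMeasure P] {r : ℕ} {W : WhiteNoiseSpace r →ₗᵢ[ℝ] Lp ℝ 2 P}
    (hW : ∀ h, P.map (W h) = gaussianReal 0 (‖h‖ ^ 2).toNNReal) (i : Fin r) {A : ℝ} (hA : 0 < A)
    {N : ℝ → ℕ} {Δ : ℝ → ℝ} (h : IsAdaptiveScheme N Δ) :
    ∀ᶠ ε in 𝓝[>] (0 : ℝ), ∃ u ∈ Icc 0 A,
      ENNReal.ofReal (1 / 8 * (1 / (N ε : ℝ) ^ (1 / 3 : ℝ)))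
        ≤ covError P (movingAverage W) (N ε) (Δ ε) u := by
  filter_upwards [self_mem_nhdsWithin, h.tendsto_zero.eventually_lt_const hA,
    h.tendsto_zero.eventually_lt_const zero_lt_one,
    h.tendsto_atTop.eventually_ge_atTop 20000] with ε hε hΔA hΔ1 hNΔ
  have hΔ := h.pos ε hε
  have hN0 : 0 < N ε := by
    rcases Nat.eq_zero_or_pos (N ε) with h0 | h0
    · rw [h0] at hNΔ; norm_num at hNΔ
    · exact h0
  set y := (N ε : ℝ) ^ (1 / 3 : ℝ) with hy
  have hy0 : 0 < y := Real.rpow_pos_of_pos (by exact_mod_cast hN0) _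
  have hy3 : y ^ 3 = N ε := cast_eq_rpow_third_pow _
  -- A coarse grid is defeated by the bias at lag `3Δ / 4`, a fine one by the fluctuations at lag
  -- `0`; the latter use `NΔ ≤ y²`.
  rcases le_total (1 / y) (Δ ε) with hle | hle
  · refine ⟨3 / 4 * Δ ε, ⟨by positivity, by linarith⟩,
      le_trans (ENNReal.ofReal_le_ofReal ?_) (bias_le_covError hW i hN0 hΔ hΔ1.le)⟩
    have : 0 < 1 / y := by positivity
    linarith
  · refine ⟨0, ⟨le_rfl, hA.le⟩,
      le_trans (ENNReal.ofReal_le_ofReal ?_) (fluctuation_le_covError hW i hΔ hΔ1.le hNΔ)⟩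
    refine Real.le_sqrt_of_sq_le ?_
    have h1 : (N ε : ℝ) * Δ ε ≤ y ^ 2 := by
      calc (N ε : ℝ) * Δ ε ≤ y ^ 3 * (1 / y) := by rw [hy3]; gcongr
        _ = y ^ 2 := by field_simp
    calc (1 / 8 * (1 / y)) ^ 2 = 1 / (64 * y ^ 2) := by field_simp; norm_num
      _ ≤ 1 / (32 * (N ε * Δ ε)) := by
          apply one_div_le_one_div_of_le
          · have : 0 < (N ε : ℝ) * Δ ε := by linarith
            positivity
          · nlinarith [sq_nonneg y]

end LowerBound

/-! ### Moment inequalities and the variance of empirical means -/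

section FourthMoments

variable {Ω : Type*} [MeasurableSpace Ω] {P : Measure Ω}

lemma MeasureTheory.MemLp.integrable_pow_four {g : Ω → ℝ} (hg : MemLp g 4 P) :
    Integrable (fun ω => g ω ^ 4) P := by
  have := (hg.mul_of_four hg).integrable_sq
  refine this.congr (ae_of_all _ fun ω => ?_)
  simp only; ring

lemma integrable_mul_mul_of_four {a b c d : Ω → ℝ} (ha : MemLp a 4 P) (hb : MemLp b 4 P)
    (hc : MemLp c 4 P) (hd : MemLp d 4 P) :
    Integrable (fun ω => a ω * b ω * (c ω * d ω)) P :=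
  (ha.mul_of_four hb).integrable_mul (hc.mul_of_four hd)

lemma abs_integral_mul_mul_le {a b c d : Ω → ℝ} (ha : MemLp a 4 P) (hb : MemLp b 4 P)
    (hc : MemLp c 4 P) (hd : MemLp d 4 P) {M : ℝ} (ha' : ∫ ω, a ω ^ 4 ∂P ≤ M)
    (hb' : ∫ ω, b ω ^ 4 ∂P ≤ M) (hc' : ∫ ω, c ω ^ 4 ∂P ≤ M) (hd' : ∫ ω, d ω ^ 4 ∂P ≤ M) :
    |∫ ω, a ω * b ω * (c ω * d ω) ∂P| ≤ M := by
  have ia := ha.integrable_pow_four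
  have ib := hb.integrable_pow_four
  have ic := hc.integrable_pow_four
  have id := hd.integrable_pow_four
  have iab : Integrable (fun ω => a ω ^ 4 + b ω ^ 4) P := ia.add ib
  have icd : Integrable (fun ω => c ω ^ 4 + d ω ^ 4) P := ic.add id
  have iall : Integrable (fun ω => a ω ^ 4 + b ω ^ 4 + (c ω ^ 4 + d ω ^ 4)) P := iab.add icd
  calc |∫ ω, a ω * b ω * (c ω * d ω) ∂P|
      ≤ ∫ ω, (1 / 4) * (a ω ^ 4 + b ω ^ 4 + (c ω ^ 4 + d ω ^ 4)) ∂P := by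
        rw [← Real.norm_eq_abs]
        refine norm_integral_le_of_norm_le (iall.const_mul _) (ae_of_all _ fun ω => ?_)
        rw [Real.norm_eq_abs, abs_le]
        constructor
        · nlinarith [sq_nonneg (a ω * b ω + c ω * d ω), sq_nonneg (a ω ^ 2 - b ω ^ 2),
            sq_nonneg (c ω ^ 2 - d ω ^ 2)]
        · nlinarith [sq_nonneg (a ω * b ω - c ω * d ω), sq_nonneg (a ω ^ 2 - b ω ^ 2),
            sq_nonneg (c ω ^ 2 - d ω ^ 2)]
    _ = (1 / 4) * (∫ ω, a ω ^ 4 ∂P + ∫ ω, b ω ^ 4 ∂P + (∫ ω, c ω ^ 4 ∂P + ∫ ω, d ω ^ 4 ∂P)) := by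
        rw [integral_const_mul, integral_add iab icd, integral_add ia ib, integral_add ic id]
    _ ≤ M := by linarith

variable [IsProbabilityMeasure P]

/-- Pointwise `|ab| ≤ 1 + (a⁴ + b⁴) / 2`. Only the dependence of constants on `M` matters, so crude
bounds without roots suffice. -/
lemma abs_integral_mul_le_of_four {a b : Ω → ℝ} (ha : MemLp a 4 P) (hb : MemLp b 4 P) {M : ℝ}
    (ha' : ∫ ω, a ω ^ 4 ∂P ≤ M) (hb' : ∫ ω, b ω ^ 4 ∂P ≤ M) :
    |∫ ω, a ω * b ω ∂P| ≤ 1 + M := by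
  have ia := ha.integrable_pow_four
  have ib := hb.integrable_pow_four
  have iab : Integrable (fun ω => a ω ^ 4 + b ω ^ 4) P := ia.add ib
  calc |∫ ω, a ω * b ω ∂P| ≤ ∫ ω, (1 + (1 / 2) * (a ω ^ 4 + b ω ^ 4)) ∂P := by
        rw [← Real.norm_eq_abs]
        refine norm_integral_le_of_norm_le ((integrable_const _).add (iab.const_mul _))
          (ae_of_all _ fun ω => ?_)
        rw [Real.norm_eq_abs, abs_le]
        constructor
        · nlinarith [sq_nonneg (a ω + b ω), sq_nonneg (a ω ^ 2 - 1), sq_nonneg (b ω ^ 2 - 1)]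
        · nlinarith [sq_nonneg (a ω - b ω), sq_nonneg (a ω ^ 2 - 1), sq_nonneg (b ω ^ 2 - 1)]
    _ = 1 + (1 / 2) * (∫ ω, a ω ^ 4 ∂P + ∫ ω, b ω ^ 4 ∂P) := by
        rw [integral_add (integrable_const _) (iab.const_mul _), integral_const_mul,
          integral_add ia ib]
        simp
    _ ≤ 1 + M := by linarith

lemma abs_integral_le_of_four {a : Ω → ℝ} (ha : MemLp a 4 P) {M : ℝ}
    (ha' : ∫ ω, a ω ^ 4 ∂P ≤ M) : |∫ ω, a ω ∂P| ≤ 1 + M := by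
  have ia := ha.integrable_pow_four
  calc |∫ ω, a ω ∂P| ≤ ∫ ω, (1 + a ω ^ 4) ∂P := by
        rw [← Real.norm_eq_abs]
        refine norm_integral_le_of_norm_le ((integrable_const _).add ia)
          (ae_of_all _ fun ω => ?_)
        rw [Real.norm_eq_abs, abs_le]
        constructor
        · nlinarith [sq_nonneg (a ω + 1 / 2), sq_nonneg (a ω ^ 2 - 1 / 2)]
        · nlinarith [sq_nonneg (a ω - 1 / 2), sq_nonneg (a ω ^ 2 - 1 / 2)]
    _ = 1 + ∫ ω, a ω ^ 4 ∂P := by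
        rw [integral_add (integrable_const _) ia]
        simp
    _ ≤ 1 + M := by linarith

lemma integral_sub_const_pow_four_le {a : Ω → ℝ} (ha : MemLp a 4 P) {M m : ℝ}
    (ha' : ∫ ω, a ω ^ 4 ∂P ≤ M) (hm : |m| ≤ M) :
    ∫ ω, (a ω - m) ^ 4 ∂P ≤ 8 * (M + M ^ 4) := by
  have ia := ha.integrable_pow_four
  calc ∫ ω, (a ω - m) ^ 4 ∂P ≤ ∫ ω, (8 * a ω ^ 4 + 8 * m ^ 4) ∂P := by
        refine integral_mono (ha.sub (memLp_const m)).integrable_pow_four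
          ((ia.const_mul _).add (integrable_const _)) fun ω => ?_
        simp only
        have h1 : (a ω - m) ^ 2 ≤ 2 * (a ω ^ 2 + m ^ 2) := by nlinarith [sq_nonneg (a ω + m)]
        have h2 : ((a ω - m) ^ 2) ^ 2 ≤ (2 * (a ω ^ 2 + m ^ 2)) ^ 2 := by gcongr
        nlinarith [sq_nonneg (a ω ^ 2 - m ^ 2)]
    _ = 8 * ∫ ω, a ω ^ 4 ∂P + 8 * m ^ 4 := by
        rw [integral_add (ia.const_mul _) (integrable_const _), integral_const_mul]
        simp
    _ ≤ 8 * (M + M ^ 4) := by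
        have : m ^ 4 ≤ M ^ 4 := by
          rw [← (by decide : Even 4).pow_abs m]
          gcongr
        linarith

/-- The variance of an empirical mean, in terms of an envelope for the covariances. -/
lemma integral_sq_mean_sub_le {Y : ℕ → Ω → ℝ} {y : ℝ} {N : ℕ} (hN : 1 ≤ N)
    (hY : ∀ n ∈ Finset.Icc 1 N, MemLp (Y n) 2 P) (hmean : ∀ n ∈ Finset.Icc 1 N, ∫ ω, Y n ω ∂P = y)
    {f : ℝ → ℝ} (hpos : ∀ T, 0 < T → 0 < f T)
    (hanti : AntitoneOn f (Ioi 0)) (hint : IntegrableOn f (Ioi 1)) {M B Δ : ℝ} (hM : 0 ≤ M)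
    (hB : 0 ≤ B) (hΔ : 0 < Δ) (hΔ1 : Δ ≤ 1)
    (hcovM : ∀ a ∈ Finset.Icc 1 N, ∀ b ∈ Finset.Icc 1 N,
      |(∫ ω, Y a ω * Y b ω ∂P) - (∫ ω, Y a ω ∂P) * ∫ ω, Y b ω ∂P| ≤ M)
    (hcovf : ∀ a ∈ Finset.Icc 1 N, ∀ b ∈ Finset.Icc 1 N, B + 2 < ((b : ℝ) - a) * Δ →
      |(∫ ω, Y a ω * Y b ω ∂P) - (∫ ω, Y a ω ∂P) * ∫ ω, Y b ω ∂P| ≤ f (((b : ℝ) - a) * Δ - B)) :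
    ∫ ω, (1 / (N : ℝ) * ∑ n ∈ Finset.Icc 1 N, Y n ω - y) ^ 2 ∂P
      ≤ 2 * (M * (B + 4) + ∫ T in Ioi (1 : ℝ), f T) / (N * Δ) := by
  have hN0 : (0 : ℝ) < N := by exact_mod_cast hN
  have hcov : ∀ a ∈ Finset.Icc 1 N, ∀ b ∈ Finset.Icc 1 N,
      ∫ ω, (Y a ω - y) * (Y b ω - y) ∂P
        = (∫ ω, Y a ω * Y b ω ∂P) - (∫ ω, Y a ω ∂P) * ∫ ω, Y b ω ∂P := by
    intro a ha b hb
    have h := covariance_eq_sub (hY a ha) (hY b hb)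
    rw [covariance, hmean a ha, hmean b hb] at h
    rw [h, hmean a ha, hmean b hb]
    rfl
  have hbound : ∀ a ∈ Finset.Icc 1 N, ∀ b ∈ Finset.Icc 1 N,
      ∫ ω, (Y a ω - y) * (Y b ω - y) ∂P ≤ rateEnvelope f M B (Nat.dist a b * Δ) := by
    intro a ha b hb
    rw [rateEnvelope]
    have h1 := (le_abs_self _).trans (hcovM a ha b hb)
    split_ifs with h
    · rwa [hcov a ha b hb]
    · push Not at h
      refine le_min (by rwa [hcov a ha b hb]) ?_
      rcases le_total a b with hab | hab
      · rw [Nat.dist_eq_sub_of_le hab, Nat.cast_sub hab] at h ⊢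
        rw [hcov a ha b hb]
        exact (le_abs_self _).trans (hcovf a ha b hb h)
      -- The decay hypothesis is one-sided in time; the other order follows by symmetry of the
      -- covariance.
      · rw [Nat.dist_eq_sub_of_le_right hab, Nat.cast_sub hab] at h ⊢
        simp only [mul_comm (Y a _ - y)]
        rw [hcov b hb a ha]
        exact (le_abs_self _).trans (hcovf b hb a ha h)
  have hi : ∀ a ∈ Finset.Icc 1 N, ∀ b ∈ Finset.Icc 1 N,
      Integrable (fun ω => (Y a ω - y) * (Y b ω - y)) P := fun a ha b hb =>
    ((hY a ha).sub (memLp_const y)).integrable_mul ((hY b hb).sub (memLp_const y))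
  have e : (fun ω => (1 / (N : ℝ) * ∑ n ∈ Finset.Icc 1 N, Y n ω - y) ^ 2)
      = fun ω => (1 / (N : ℝ)) ^ 2 * ∑ a ∈ Finset.Icc 1 N, ∑ b ∈ Finset.Icc 1 N,
        (Y a ω - y) * (Y b ω - y) := by
    ext ω
    rw [← Finset.sum_mul_sum, ← sq, ← mul_pow, Finset.sum_sub_distrib, mul_sub]
    congr 2
    simp only [Finset.sum_const, Nat.card_Icc, add_tsub_cancel_right, nsmul_eq_mul]
    field_simp
  rw [e, integral_const_mul, integral_finsetSum _ fun a ha =>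
    integrable_finsetSum _ fun b hb => hi a ha b hb]
  calc (1 / (N : ℝ)) ^ 2 * ∑ a ∈ Finset.Icc 1 N, ∫ ω, ∑ b ∈ Finset.Icc 1 N,
        (Y a ω - y) * (Y b ω - y) ∂P
      ≤ (1 / (N : ℝ)) ^ 2 * ∑ a ∈ Finset.Icc 1 N, ∑ b ∈ Finset.Icc 1 N,
        rateEnvelope f M B (Nat.dist a b * Δ) := by
        gcongr with a ha
        rw [integral_finsetSum _ fun b hb => hi a ha b hb]
        exact Finset.sum_le_sum fun b hb => hbound a ha b hb
    _ ≤ (1 / (N : ℝ)) ^ 2 * (N * (2 * (M * (B + 4) + ∫ T in Ioi (1 : ℝ), f T) / Δ)) := by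
        gcongr
        exact sum_sum_rateEnvelope_le hpos hanti hint hM hB hΔ hΔ1 N
    _ = _ := by field_simp

/-- A property of four natural numbers that is invariant under permutations holds if it holds for
nondecreasing sequences. -/
lemma forall_of_sorted_four {p : ℕ → ℕ → ℕ → ℕ → Prop}
    (h12 : ∀ a b c d, p a b c d → p b a c d) (h23 : ∀ a b c d, p a b c d → p a c b d)
    (h34 : ∀ a b c d, p a b c d → p a b d c)
    (hs : ∀ a b c d, a ≤ b → b ≤ c → c ≤ d → p a b c d) (a b c d : ℕ) : p a b c d := by
  -- The remaining transpositions are conjugates of adjacent ones. The order hypotheses are then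
  -- removed one comparison at a time.
  have h24 : ∀ a b c d, p a b c d → p a d c b := fun a b c d h =>
    h34 _ _ _ _ (h23 _ _ _ _ (h34 _ _ _ _ h))
  have h13 : ∀ a b c d, p a b c d → p c b a d := fun a b c d h =>
    h12 _ _ _ _ (h23 _ _ _ _ (h12 _ _ _ _ h))
  have h14 : ∀ a b c d, p a b c d → p d b c a := fun a b c d h =>
    h12 _ _ _ _ (h24 _ _ _ _ (h12 _ _ _ _ h))
  have min₂₃ : ∀ a b c d, a ≤ b → b ≤ c → b ≤ d → p a b c d := fun a b c d h1 h2 h3 => by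
    rcases le_total c d with h | h
    · exact hs _ _ _ _ h1 h2 h
    · exact h34 _ _ _ _ (hs _ _ _ _ h1 h3 h)
  have min₂ : ∀ a b c d, a ≤ b → a ≤ c → a ≤ d → b ≤ d → p a b c d := fun a b c d h1 h2 h3 h4 => by
    rcases le_total b c with h | h
    · exact min₂₃ _ _ _ _ h1 h h4
    · exact h23 _ _ _ _ (min₂₃ _ _ _ _ h2 h (h.trans h4))
  have min₁ : ∀ a b c d, a ≤ b → a ≤ c → a ≤ d → p a b c d := fun a b c d h1 h2 h3 => by
    rcases le_total b d with h | h
    · exact min₂ _ _ _ _ h1 h2 h3 h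
    · exact h24 _ _ _ _ (min₂ _ _ _ _ h3 h2 h1 h)
  have le₃₄ : ∀ a b c d, a ≤ c → a ≤ d → p a b c d := fun a b c d h1 h2 => by
    rcases le_total a b with h | h
    · exact min₁ _ _ _ _ h h1 h2
    · exact h12 _ _ _ _ (min₁ _ _ _ _ h (h.trans h1) (h.trans h2))
  have le₄ : ∀ a b c d, a ≤ d → p a b c d := fun a b c d h1 => by
    rcases le_total a c with h | h
    · exact le₃₄ _ _ _ _ h h1
    · exact h13 _ _ _ _ (le₃₄ _ _ _ _ h (h.trans h1))
  rcases le_total a d with h | h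
  · exact le₄ _ _ _ _ h
  · exact h14 _ _ _ _ (le₄ _ _ _ _ h)

end FourthMoments

/-! ### Stationarity and decorrelation of centred products -/

section AdmissibleProcess

variable {Ω : Type*} [MeasurableSpace Ω] {P : Measure Ω} {r : ℕ}
  {X : ℝ → Ω → Fin r → ℝ} {f : ℝ → ℝ}

lemma IsAdmissibleProcess.memLp_apply (hX : IsAdmissibleProcess P X f) {t : ℝ} (ht : 0 ≤ t)
    (i : Fin r) : MemLp (fun ω => X t ω i) 4 P :=
  (hX.memLp t ht).eval_four i

lemma IsAdmissibleProcess.integral_comp_shift (hX : IsAdmissibleProcess P X f) {n : ℕ}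
    {t : Fin n → ℝ} (ht : ∀ k, 0 ≤ t k) {h : ℝ} (hh : 0 ≤ h) {φ : (Fin n → Fin r → ℝ) → ℝ}
    (hφ : Continuous φ) :
    ∫ ω, φ (fun k => X (t k + h) ω) ∂P = ∫ ω, φ (fun k => X (t k) ω) ∂P := by
  have hm : ∀ s : Fin n → ℝ, (∀ k, 0 ≤ s k) → AEMeasurable (fun ω k => X (s k) ω) P :=
    fun s hs => aemeasurable_pi_iff.2 fun k =>
      (hX.memLp _ (hs k)).aestronglyMeasurable.aemeasurable
  rw [← integral_map (φ := fun ω k => X (t k + h) ω) (f := φ)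
    (hm _ fun k => add_nonneg (ht k) hh) hφ.aestronglyMeasurable,
    ← integral_map (φ := fun ω k => X (t k) ω) (f := φ) (hm _ ht) hφ.aestronglyMeasurable,
    hX.stationary n t h ht hh]

lemma IsAdmissibleProcess.integral_apply (hX : IsAdmissibleProcess P X f) {t : ℝ} (ht : 0 ≤ t)
    (i : Fin r) : ∫ ω, X t ω i ∂P = ∫ ω, X 0 ω i ∂P := by
  have := hX.integral_comp_shift (t := fun _ : Fin 1 => 0) (fun _ => le_rfl) ht
    (φ := fun x => x 0 i) (by fun_prop)
  simpa using this

lemma IsAdmissibleProcess.integral_mul_apply (hX : IsAdmissibleProcess P X f) {t u : ℝ}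
    (ht : 0 ≤ t) (hu : 0 ≤ u) (i j : Fin r) :
    ∫ ω, X t ω i * X (t + u) ω j ∂P = ∫ ω, X 0 ω i * X u ω j ∂P := by
  have := hX.integral_comp_shift (t := ![0, u]) (fun k => by fin_cases k <;> simp [hu]) ht
    (φ := fun x => x 0 i * x 1 j) (by fun_prop)
  simpa [add_comm] using this

lemma IsAdmissibleProcess.integral_pow_four_le (hX : IsAdmissibleProcess P X f) {ν : ℝ≥0}
    (hν : eLpNorm (X 0) 4 P ≤ ν) {t : ℝ} (ht : 0 ≤ t) (i : Fin r) :
    ∫ ω, X t ω i ^ 4 ∂P ≤ ν ^ 4 := by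
  have h1 := hX.integral_comp_shift (t := fun _ : Fin 1 => 0) (fun _ => le_rfl) ht
    (φ := fun x => x 0 i ^ 4) (by fun_prop)
  have h2 : ∫ ω, X t ω i ^ 4 ∂P = ∫ ω, X 0 ω i ^ 4 ∂P := by simpa using h1
  rw [h2]
  have hm := hX.memLp_apply le_rfl i
  have h3 : eLpNorm (fun ω => X 0 ω i) 4 P ≤ ν :=
    (eLpNorm_mono fun ω => norm_le_pi_norm (X 0 ω) i).trans hν
  rw [hm.eLpNorm_eq_integral_rpow_norm (by norm_num) (by norm_num)] at h3
  have h4 : ∀ ω, ‖X 0 ω i‖ ^ (4 : ℝ≥0∞).toReal = X 0 ω i ^ 4 := fun ω => by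
    rw [show (4 : ℝ≥0∞).toReal = ((4 : ℕ) : ℝ) by norm_num, Real.rpow_natCast, Real.norm_eq_abs,
      (by decide : Even 4).pow_abs]
  simp only [h4] at h3
  have hI : 0 ≤ ∫ ω, X 0 ω i ^ 4 ∂P := integral_nonneg fun ω => by positivity
  rw [← ENNReal.ofReal_coe_nnreal, ENNReal.ofReal_le_ofReal_iff (NNReal.coe_nonneg ν)] at h3
  have h5 : ((∫ ω, X 0 ω i ^ 4 ∂P) ^ (4 : ℝ≥0∞).toReal⁻¹) ^ 4 ≤ (ν : ℝ) ^ 4 := by gcongr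
  rwa [← Real.rpow_natCast, ← Real.rpow_mul hI, show (4 : ℝ≥0∞).toReal⁻¹ * ((4 : ℕ) : ℝ) = 1 by
    norm_num, Real.rpow_one] at h5

/-- Decorrelation between monomials on two compact intervals. -/
lemma HasIntegrableDecorrelationRate.abs_sub_le (hf : HasIntegrableDecorrelationRate P X f)
    {a b c d : ℝ} (ha : 0 ≤ a) (hab : a ≤ b) (hbc : b < c) (hcd : c ≤ d) {G H : Ω → ℝ}
    (hG : G ∈ lagMonomials X (Icc a b)) (hH : H ∈ lagMonomials X (Icc c d)) :
    |(∫ ω, G ω * H ω ∂P) - (∫ ω, G ω ∂P) * ∫ ω, H ω ∂P| ≤ f (c - b) := by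
  refine hf.decorrelation (Icc a b) (Icc c d) (c - b) (fun x hx => ha.trans hx.1)
    (fun x hx => ha.trans (hab.trans (hbc.le.trans hx.1))) ordConnected_Icc ordConnected_Icc
    ⟨a, le_rfl, hab⟩ ⟨c, le_rfl, hcd⟩ (sub_pos.2 hbc) ⟨?_, ?_⟩ G hG H hH
  · rintro _ ⟨u, hu, v, hv, rfl⟩
    exact sub_le_sub hv.1 hu.2
  · intro x hx
    exact hx ⟨b, ⟨hab, le_rfl⟩, c, ⟨le_rfl, hcd⟩, rfl⟩

variable [IsProbabilityMeasure P]

lemma IsAdmissibleProcess.abs_integral_centered_mul_le (hX : IsAdmissibleProcess P X f)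
    {a b : ℝ} (ha : 0 ≤ a) (hab : a < b) (i : Fin r) {m : ℝ} (hm : ∫ ω, X 0 ω i ∂P = m) :
    |∫ ω, (X a ω i - m) * (X b ω i - m) ∂P| ≤ f (b - a) := by
  have hb : 0 ≤ b := ha.trans hab.le
  have ia := (hX.memLp_apply ha i).mono_exponent (q := 4) (p := 2) (by norm_num)
  have ib := (hX.memLp_apply hb i).mono_exponent (q := 4) (p := 2) (by norm_num)
  have h := covariance_eq_sub ia ib
  rw [covariance, hX.integral_apply ha i, hX.integral_apply hb i, hm] at h
  rw [h]
  have := hX.decorrelation.abs_sub_le ha le_rfl hab le_rfl (G := fun ω => X a ω i)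
    (H := fun ω => X b ω i) (Or.inl ⟨a, ⟨le_rfl, le_rfl⟩, i, rfl⟩)
    (Or.inl ⟨b, ⟨le_rfl, le_rfl⟩, i, rfl⟩)
  rwa [hX.integral_apply ha i, hX.integral_apply hb i, hm] at this

/-- The rate controls uncentred monomials only. Up to constants, a centred product is `X_s X_t - m
(X_s + X_t)`, so bilinearity expands the covariance into nine terms with total weight at most `(1 +
2κ)²`. -/
lemma IsAdmissibleProcess.abs_centered_decorrelation_le (hX : IsAdmissibleProcess P X f)
    {a b c d : ℝ} (ha : 0 ≤ a) (hab : a ≤ b) (hbc : b < c) (hcd : c ≤ d) (i : Fin r) {m κ : ℝ}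
    (hm : |m| ≤ κ) :
    |(∫ ω, (X a ω i - m) * (X b ω i - m) * ((X c ω i - m) * (X d ω i - m)) ∂P)
      - (∫ ω, (X a ω i - m) * (X b ω i - m) ∂P) * ∫ ω, (X c ω i - m) * (X d ω i - m) ∂P|
      ≤ (1 + 2 * κ) ^ 2 * f (c - b) := by
  have hb : 0 ≤ b := ha.trans hab
  have hc : 0 ≤ c := hb.trans hbc.le
  have hd : 0 ≤ d := hc.trans hcd
  have L4 : ∀ t, 0 ≤ t → MemLp (fun ω => X t ω i) 4 P := fun t ht => hX.memLp_apply ht i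
  have L2 : ∀ t, 0 ≤ t → MemLp (fun ω => X t ω i) 2 P := fun t ht =>
    (L4 t ht).mono_exponent (by norm_num)
  have LL : ∀ s t, 0 ≤ s → 0 ≤ t → MemLp (fun ω => X s ω i * X t ω i) 2 P := fun s t hs ht =>
    (L4 s hs).mul_of_four (L4 t ht)
  have hcov : ∀ G H : Ω → ℝ, MemLp G 2 P → MemLp H 2 P → G ∈ lagMonomials X (Icc a b) →
      H ∈ lagMonomials X (Icc c d) → |cov[G, H; P]| ≤ f (c - b) := by
    intro G H hG2 hH2 hG hH
    rw [covariance_eq_sub hG2 hH2]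
    exact hX.decorrelation.abs_sub_le ha hab hbc hcd hG hH
  have expand : ∀ s t, (fun ω => (X s ω i - m) * (X t ω i - m))
      = fun ω => (X s ω i * X t ω i - m * (X s ω i + X t ω i)) + m ^ 2 := fun s t => by
    ext ω; ring
  have Lc : ∀ s t, 0 ≤ s → 0 ≤ t → MemLp (fun ω => (X s ω i - m) * (X t ω i - m)) 2 P :=
    fun s t hs ht => ((L4 s hs).sub (memLp_const m)).mul_of_four ((L4 t ht).sub (memLp_const m))
  have Ls : ∀ s t, 0 ≤ s → 0 ≤ t → MemLp (fun ω => X s ω i + X t ω i) 2 P := fun s t hs ht =>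
    (L2 s hs).add (L2 t ht)
  have Lm : ∀ s t, 0 ≤ s → 0 ≤ t →
      MemLp (fun ω => X s ω i * X t ω i - m * (X s ω i + X t ω i)) 2 P := fun s t hs ht =>
    (LL s t hs ht).sub ((Ls s t hs ht).const_mul m)
  have ma : a ∈ Icc a b := ⟨le_rfl, hab⟩
  have mb : b ∈ Icc a b := ⟨hab, le_rfl⟩
  have mc : c ∈ Icc c d := ⟨le_rfl, hcd⟩
  have md : d ∈ Icc c d := ⟨hcd, le_rfl⟩
  have hf0 : 0 ≤ f (c - b) := (hX.decorrelation.pos _ (sub_pos.2 hbc)).le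
  have hκ : 0 ≤ κ := (abs_nonneg m).trans hm
  have bound : ∀ G : Ω → ℝ, MemLp G 2 P → G ∈ lagMonomials X (Icc a b) →
      |cov[G, fun ω => X c ω i * X d ω i - m * (X c ω i + X d ω i); P]|
        ≤ (1 + 2 * κ) * f (c - b) := by
    intro G hG2 hG
    have e : cov[G, fun ω => X c ω i * X d ω i - m * (X c ω i + X d ω i); P]
        = cov[G, fun ω => X c ω i * X d ω i; P]
          - m * (cov[G, fun ω => X c ω i; P] + cov[G, fun ω => X d ω i; P]) := by
      rw [covariance_fun_sub_right hG2 (LL c d hc hd) ((Ls c d hc hd).const_mul m),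
        covariance_const_mul_right]
      congr 2
      exact covariance_add_right hG2 (L2 c hc) (L2 d hd)
    rw [e]
    have h1 := hcov G _ hG2 (LL c d hc hd) hG (Or.inr ⟨c, mc, d, md, i, i, rfl⟩)
    have h2 := hcov G _ hG2 (L2 c hc) hG (Or.inl ⟨c, mc, i, rfl⟩)
    have h3 := hcov G _ hG2 (L2 d hd) hG (Or.inl ⟨d, md, i, rfl⟩)
    refine (abs_sub _ _).trans ?_
    rw [abs_mul]
    have h4 := (abs_add_le _ _).trans (add_le_add h2 h3)
    have h5 := mul_le_mul hm h4 (abs_nonneg _) hκ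
    linarith
  have e : (∫ ω, (X a ω i - m) * (X b ω i - m) * ((X c ω i - m) * (X d ω i - m)) ∂P)
      - (∫ ω, (X a ω i - m) * (X b ω i - m) ∂P) * ∫ ω, (X c ω i - m) * (X d ω i - m) ∂P
      = cov[fun ω => X a ω i * X b ω i - m * (X a ω i + X b ω i),
          fun ω => X c ω i * X d ω i - m * (X c ω i + X d ω i); P] := by
    have := covariance_eq_sub (Lc a b ha hb) (Lc c d hc hd)
    refine this.symm.trans ?_
    rw [expand a b, expand c d,
      covariance_add_const_left ((Lm a b ha hb).integrable (by norm_num)),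
      covariance_add_const_right ((Lm c d hc hd).integrable (by norm_num))]
  rw [e, covariance_fun_sub_left (LL a b ha hb) ((Ls a b ha hb).const_mul m) (Lm c d hc hd),
    covariance_const_mul_left]
  have e2 : cov[fun ω => X a ω i + X b ω i,
      fun ω => X c ω i * X d ω i - m * (X c ω i + X d ω i); P]
      = cov[fun ω => X a ω i, fun ω => X c ω i * X d ω i - m * (X c ω i + X d ω i); P]
      + cov[fun ω => X b ω i, fun ω => X c ω i * X d ω i - m * (X c ω i + X d ω i); P] :=
    covariance_add_left (L2 a ha) (L2 b hb) (Lm c d hc hd)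
  rw [e2]
  have h1 := bound _ (LL a b ha hb) (Or.inr ⟨a, ma, b, mb, i, i, rfl⟩)
  have h2 := bound _ (L2 a ha) (Or.inl ⟨a, ma, i, rfl⟩)
  have h3 := bound _ (L2 b hb) (Or.inl ⟨b, mb, i, rfl⟩)
  refine (abs_sub _ _).trans ?_
  rw [abs_mul]
  have h4 := (abs_add_le _ _).trans (add_le_add h2 h3)
  have h5 := mul_le_mul hm h4 (abs_nonneg _) hκ
  linarith

end AdmissibleProcess

/-! ### Fourth moments of empirical means -/

section UpperBound

variable {Ω : Type*} [MeasurableSpace Ω] {P : Measure Ω} [IsProbabilityMeasure P] {r : ℕ}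
  {X : ℝ → Ω → Fin r → ℝ} {f : ℝ → ℝ}

/-- Each of the six pair terms leaves two free indices, which contribute the factor `card²`. -/
lemma sum_product_pairs_le {s : Finset ℕ} {F : ℕ → ℕ → ℕ → ℕ → ℝ} {ψ : ℕ → ℕ → ℝ} {D : ℝ}
    (hF : ∀ a ∈ s, ∀ b ∈ s, ∀ c ∈ s, ∀ d ∈ s,
      F a b c d ≤ ψ a b + ψ a c + ψ a d + ψ b c + ψ b d + ψ c d)
    (hD : ∑ a ∈ s, ∑ b ∈ s, ψ a b ≤ D) :
    ∑ a ∈ s, ∑ b ∈ s, ∑ c ∈ s, ∑ d ∈ s, F a b c d ≤ 6 * (s.card : ℝ) ^ 2 * D := by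
  refine (Finset.sum_le_sum fun a ha => Finset.sum_le_sum fun b hb => Finset.sum_le_sum fun c hc =>
    Finset.sum_le_sum fun d hd => hF a ha b hb c hc d hd).trans ?_
  have : ∑ a ∈ s, ∑ b ∈ s, ∑ c ∈ s, ∑ d ∈ s, (ψ a b + ψ a c + ψ a d + ψ b c + ψ b d + ψ c d)
      = 6 * (s.card : ℝ) ^ 2 * ∑ a ∈ s, ∑ b ∈ s, ψ a b := by
    simp only [Finset.sum_add_distrib, Finset.sum_const, nsmul_eq_mul, ← Finset.mul_sum]
    ring
  rw [this]
  gcongr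

/-- Fourth order moments of the centred process are controlled by the time gaps. -/
lemma IsAdmissibleProcess.abs_integral_centered_four_le (hX : IsAdmissibleProcess P X f)
    {κ M C : ℝ} (hκ : ∀ t, 0 ≤ t → ∀ i, ∫ ω, X t ω i ^ 4 ∂P ≤ κ)
    (hM : M = 8 * (κ + κ ^ 4)) (hC : C = (1 + 2 * κ) ^ 2 + (1 + M)) {k : ℤ} (hk : 0 ≤ k) {Δ : ℝ}
    (hΔ : 0 < Δ) (i : Fin r) {m : ℝ} (hm : ∫ ω, X 0 ω i ∂P = m) (hmκ : |m| ≤ κ) {a b c d : ℕ}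
    (hab : a ≤ b) (hbc : b ≤ c) (hcd : c ≤ d) :
    |∫ ω, (X ((a + k) * Δ) ω i - m) * (X ((b + k) * Δ) ω i - m)
        * ((X ((c + k) * Δ) ω i - m) * (X ((d + k) * Δ) ω i - m)) ∂P|
      ≤ rateEnvelope (fun T => C * f T) M 0 (Nat.dist a b * Δ)
        + rateEnvelope (fun T => C * f T) M 0 (Nat.dist b c * Δ) := by
  have hk' : (0 : ℝ) ≤ k := by exact_mod_cast hk
  have ht : ∀ n : ℕ, 0 ≤ ((n : ℝ) + k) * Δ := fun n => by positivity
  have hκ0 : 0 ≤ κ := (abs_nonneg m).trans hmκ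
  have hM0 : 0 ≤ M := by rw [hM]; positivity
  have hC0 : 0 < C := by rw [hC]; positivity
  have hpos : ∀ T, 0 < T → 0 < C * f T := fun T hT => mul_pos hC0 (hX.decorrelation.pos T hT)
  have L4 : ∀ n : ℕ, MemLp (fun ω => X ((n + k) * Δ) ω i - m) 4 P := fun n =>
    (hX.memLp_apply (ht n) i).sub (memLp_const m)
  have B4 : ∀ n : ℕ, ∫ ω, (X ((n + k) * Δ) ω i - m) ^ 4 ∂P ≤ M := fun n => by
    rw [hM]
    exact integral_sub_const_pow_four_le (hX.memLp_apply (ht n) i) (hκ _ (ht n) i) hmκ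
  have hall := abs_integral_mul_mul_le (L4 a) (L4 b) (L4 c) (L4 d) (B4 a) (B4 b) (B4 c) (B4 d)
  have hab' : (a : ℝ) ≤ b := by exact_mod_cast hab
  have hbc' : (b : ℝ) ≤ c := by exact_mod_cast hbc
  have hcd' : (c : ℝ) ≤ d := by exact_mod_cast hcd
  rw [Nat.dist_eq_sub_of_le hab, Nat.dist_eq_sub_of_le hbc, Nat.cast_sub hab, Nat.cast_sub hbc]
  have hn1 := rateEnvelope_nonneg (f := fun T => C * f T) hpos (B := 0) (x := ((b : ℝ) - a) * Δ) hM0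
  have hn2 := rateEnvelope_nonneg (f := fun T => C * f T) hpos (B := 0) (x := ((c : ℝ) - b) * Δ) hM0
  unfold rateEnvelope at hn1 hn2 ⊢
  split_ifs at hn1 hn2 ⊢ with h1 h2 h2
  · linarith
  · linarith
  · linarith
  · rw [zero_add] at h1 h2
    push Not at h1 h2
    simp only [sub_zero] at hn1 hn2 ⊢
    -- Both gaps exceed `2`. Splitting at the middle gap gives a covariance bounded by `f` of that
    -- gap plus a product of pair moments bounded by `(1 + M)` times `f` of the first gap; `C`
    -- collects both constants.
    have hdec := hX.abs_centered_decorrelation_le (ht a) (b := (b + k) * Δ) (c := (c + k) * Δ)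
      (d := (d + k) * Δ) (by gcongr) (by nlinarith) (by gcongr) i hmκ
    have hpair := hX.abs_integral_centered_mul_le (ht a) (b := (b + k) * Δ) (by nlinarith) i hm
    have hcdM := abs_integral_mul_le_of_four (L4 c) (L4 d) (B4 c) (B4 d)
    rw [show ((c : ℝ) + k) * Δ - (b + k) * Δ = (c - b) * Δ by ring] at hdec
    rw [show ((b : ℝ) + k) * Δ - (a + k) * Δ = (b - a) * Δ by ring] at hpair
    have hf1 := hX.decorrelation.pos (((b : ℝ) - a) * Δ) (by linarith)
    have hf2 := hX.decorrelation.pos (((c : ℝ) - b) * Δ) (by linarith)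
    -- If either minimum is `M`, the plain moment bound already suffices.
    rcases min_choice M (C * f ((b - a) * Δ)) with e1 | e1
    · rw [e1]; linarith
    rcases min_choice M (C * f ((c - b) * Δ)) with e2 | e2
    · rw [e2]; linarith
    rw [e1, e2]
    have hprod : |(∫ ω, (X ((a + k) * Δ) ω i - m) * (X ((b + k) * Δ) ω i - m) ∂P)
        * ∫ ω, (X ((c + k) * Δ) ω i - m) * (X ((d + k) * Δ) ω i - m) ∂P|
        ≤ f ((b - a) * Δ) * (1 + M) := by
      rw [abs_mul]
      exact mul_le_mul hpair hcdM (abs_nonneg _) hf1.le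
    have htri := abs_sub_abs_le_abs_sub
      (∫ ω, (X ((a + k) * Δ) ω i - m) * (X ((b + k) * Δ) ω i - m)
        * ((X ((c + k) * Δ) ω i - m) * (X ((d + k) * Δ) ω i - m)) ∂P)
      ((∫ ω, (X ((a + k) * Δ) ω i - m) * (X ((b + k) * Δ) ω i - m) ∂P)
        * ∫ ω, (X ((c + k) * Δ) ω i - m) * (X ((d + k) * Δ) ω i - m) ∂P)
    have hC1 : (1 + 2 * κ) ^ 2 * f ((c - b) * Δ) ≤ C * f ((c - b) * Δ) := by
      gcongr; rw [hC]; linarith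
    have hC2 : f ((b - a) * Δ) * (1 + M) ≤ C * f ((b - a) * Δ) := by
      rw [mul_comm]; gcongr; rw [hC]; nlinarith [sq_nonneg (1 + 2 * κ)]
    linarith

lemma IsAdmissibleProcess.integral_shiftedMean_sub_pow_four_le (hX : IsAdmissibleProcess P X f)
    {κ M C : ℝ} (hκ : ∀ t, 0 ≤ t → ∀ i, ∫ ω, X t ω i ^ 4 ∂P ≤ κ)
    (hM : M = 8 * (κ + κ ^ 4)) (hC : C = (1 + 2 * κ) ^ 2 + (1 + M)) {k : ℤ} (hk : 0 ≤ k) {Δ : ℝ}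
    (hΔ : 0 < Δ) (hΔ1 : Δ ≤ 1) {N : ℕ} (hN : 1 ≤ N) (i : Fin r) {m : ℝ}
    (hm : ∫ ω, X 0 ω i ∂P = m) (hmκ : |m| ≤ κ) :
    ∫ ω, (shiftedMean X N Δ k ω i - m) ^ 4 ∂P
      ≤ 12 * (4 * M + C * ∫ T in Ioi (1 : ℝ), f T) / (N * Δ) := by
  have hN0 : (0 : ℝ) < N := by exact_mod_cast hN
  have hk' : (0 : ℝ) ≤ k := by exact_mod_cast hk
  have ht : ∀ n : ℕ, 0 ≤ ((n : ℝ) + k) * Δ := fun n => by positivity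
  have hκ0 : 0 ≤ κ := (abs_nonneg m).trans hmκ
  have hM0 : 0 ≤ M := by rw [hM]; positivity
  have hC0 : 0 < C := by rw [hC]; positivity
  have hpos : ∀ T, 0 < T → 0 < C * f T := fun T hT => mul_pos hC0 (hX.decorrelation.pos T hT)
  set y : ℕ → Ω → ℝ := fun n ω => X ((n + k) * Δ) ω i - m with hy
  have L4 : ∀ n : ℕ, MemLp (y n) 4 P := fun n =>
    (hX.memLp_apply (ht n) i).sub (memLp_const m)
  set ψ : ℕ → ℕ → ℝ := fun a b => rateEnvelope (fun T => C * f T) M 0 (Nat.dist a b * Δ) with hψ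
  have ψ0 : ∀ a b, 0 ≤ ψ a b := fun a b => rateEnvelope_nonneg hpos hM0
  have ψs : ∀ a b, ψ a b = ψ b a := fun a b => by simp only [hψ, Nat.dist_comm]
  -- Summing over all six pairs makes the bound invariant under permutations, so ordered indices
  -- suffice.
  have key : ∀ a b c d : ℕ, |∫ ω, y a ω * y b ω * (y c ω * y d ω) ∂P|
      ≤ ψ a b + ψ a c + ψ a d + ψ b c + ψ b d + ψ c d := by
    refine forall_of_sorted_four ?_ ?_ ?_ ?_
    · intro a b c d h
      rw [show (fun ω => y b ω * y a ω * (y c ω * y d ω))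
        = fun ω => y a ω * y b ω * (y c ω * y d ω) by ext ω; ring, ψs b a]
      linarith
    · intro a b c d h
      rw [show (fun ω => y a ω * y c ω * (y b ω * y d ω))
        = fun ω => y a ω * y b ω * (y c ω * y d ω) by ext ω; ring, ψs c b]
      linarith
    · intro a b c d h
      rw [show (fun ω => y a ω * y b ω * (y d ω * y c ω))
        = fun ω => y a ω * y b ω * (y c ω * y d ω) by ext ω; ring, ψs d c]
      linarith
    · intro a b c d hab hbc hcd
      have := hX.abs_integral_centered_four_le hκ hM hC hk hΔ i hm hmκ hab hbc hcd
      have h2 : |∫ ω, y a ω * y b ω * (y c ω * y d ω) ∂P| ≤ ψ a b + ψ b c := this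
      linarith [ψ0 a c, ψ0 a d, ψ0 b d, ψ0 c d]
  have hint : ∀ a b c d : ℕ, Integrable (fun ω => y a ω * y b ω * (y c ω * y d ω)) P :=
    fun a b c d => integrable_mul_mul_of_four (L4 a) (L4 b) (L4 c) (L4 d)
  have e : (fun ω => (shiftedMean X N Δ k ω i - m) ^ 4) = fun ω => (1 / (N : ℝ)) ^ 4 *
      ∑ a ∈ Finset.Icc 1 N, ∑ b ∈ Finset.Icc 1 N, ∑ c ∈ Finset.Icc 1 N, ∑ d ∈ Finset.Icc 1 N,
        y a ω * y b ω * (y c ω * y d ω) := by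
    ext ω
    have h1 : shiftedMean X N Δ k ω i - m = 1 / (N : ℝ) * ∑ n ∈ Finset.Icc 1 N, y n ω := by
      simp only [hy, Finset.sum_sub_distrib, Finset.sum_const, Nat.card_Icc, add_tsub_cancel_right,
        nsmul_eq_mul, shiftedMean, Pi.smul_apply, Finset.sum_apply, smul_eq_mul, mul_sub]
      rw [← mul_assoc (1 / (N : ℝ)) (N : ℝ) m, one_div, inv_mul_cancel₀ hN0.ne', one_mul]
    rw [h1, mul_pow]
    congr 1
    simp only [← Finset.mul_sum, ← Finset.sum_mul]
    ring
  have hDsum := sum_sum_rateEnvelope_le (f := fun T => C * f T) (M := M) (B := 0) hpos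
    (fun a ha b hb hab => mul_le_mul_of_nonneg_left (hX.decorrelation.antitone ha hb hab) hC0.le)
    (hX.decorrelation.integrable.const_mul C) hM0 le_rfl hΔ hΔ1 N
  rw [integral_const_mul] at hDsum
  have hsum := sum_product_pairs_le (s := Finset.Icc 1 N)
    (F := fun a b c d => ∫ ω, y a ω * y b ω * (y c ω * y d ω) ∂P) (ψ := ψ)
    (fun a _ b _ c _ d _ => (le_abs_self _).trans (key a b c d)) hDsum
  rw [e, integral_const_mul]
  have e2 : ∫ ω, ∑ a ∈ Finset.Icc 1 N, ∑ b ∈ Finset.Icc 1 N, ∑ c ∈ Finset.Icc 1 N,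
      ∑ d ∈ Finset.Icc 1 N, y a ω * y b ω * (y c ω * y d ω) ∂P
      = ∑ a ∈ Finset.Icc 1 N, ∑ b ∈ Finset.Icc 1 N, ∑ c ∈ Finset.Icc 1 N,
      ∑ d ∈ Finset.Icc 1 N, ∫ ω, y a ω * y b ω * (y c ω * y d ω) ∂P := by
    have i1 : ∀ a b c, Integrable (fun ω => ∑ d ∈ Finset.Icc 1 N,
        y a ω * y b ω * (y c ω * y d ω)) P := fun a b c =>
      integrable_finsetSum _ fun d _ => hint a b c d
    have i2 : ∀ a b, Integrable (fun ω => ∑ c ∈ Finset.Icc 1 N, ∑ d ∈ Finset.Icc 1 N,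
        y a ω * y b ω * (y c ω * y d ω)) P := fun a b =>
      integrable_finsetSum _ fun c _ => i1 a b c
    have i3 : ∀ a, Integrable (fun ω => ∑ b ∈ Finset.Icc 1 N, ∑ c ∈ Finset.Icc 1 N,
        ∑ d ∈ Finset.Icc 1 N, y a ω * y b ω * (y c ω * y d ω)) P := fun a =>
      integrable_finsetSum _ fun b _ => i2 a b
    rw [integral_finsetSum _ fun a _ => i3 a]
    refine Finset.sum_congr rfl fun a _ => ?_
    rw [integral_finsetSum _ fun b _ => i2 a b]
    refine Finset.sum_congr rfl fun b _ => ?_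
    rw [integral_finsetSum _ fun c _ => i1 a b c]
    refine Finset.sum_congr rfl fun c _ => ?_
    rw [integral_finsetSum _ fun d _ => hint a b c d]
  rw [e2]
  calc _ ≤ (1 / (N : ℝ)) ^ 4 * (6 * ((Finset.Icc 1 N).card : ℝ) ^ 2
        * (N * (2 * (M * (0 + 4) + C * ∫ T in Ioi (1 : ℝ), f T) / Δ))) := by gcongr
    _ = _ := by
        simp only [Nat.card_Icc, add_tsub_cancel_right]
        field_simp
        ring

end UpperBound

/-! ### Quadratic error of a single entry -/

section UpperBound

variable {Ω : Type*} [MeasurableSpace Ω] {P : Measure Ω} [IsProbabilityMeasure P] {r : ℕ}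
  {X : ℝ → Ω → Fin r → ℝ} {f : ℝ → ℝ}

/-- A bound for the first, second and fourth moments of a variable with `L⁴` norm at most `ν`. -/
def momentBound (ν : ℝ) : ℝ := 1 + ν ^ 4

/-- The constant in front of `1 / (N Δ)` in the estimate of the quadratic error. -/
def fluctuationConst (A I κ : ℝ) : ℝ :=
  5 * (2 * ((κ + κ ^ 2) * (A + 1 + 4) + I)
    + 12 * (4 * (8 * (κ + κ ^ 4)) + ((1 + 2 * κ) ^ 2 + (1 + 8 * (κ + κ ^ 4))) * I)
    + 2 * κ ^ 2 * (2 * ((κ + κ ^ 2) * (0 + 4) + I)))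

lemma IsAdmissibleProcess.integral_sq_shiftedMean_sub_le (hX : IsAdmissibleProcess P X f)
    {ν : ℝ≥0} (hν : eLpNorm (X 0) 4 P ≤ ν) {k : ℤ} (hk : 0 ≤ k) {Δ : ℝ}
    (hΔ : 0 < Δ) (hΔ1 : Δ ≤ 1) {N : ℕ} (hN : 1 ≤ N) (i : Fin r) :
    ∫ ω, (shiftedMean X N Δ k ω i - ∫ ω, X 0 ω i ∂P) ^ 2 ∂P
      ≤ 2 * ((momentBound ν + momentBound ν ^ 2) * (0 + 4) + ∫ T in Ioi (1 : ℝ), f T)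
        / (N * Δ) := by
  have hk' : (0 : ℝ) ≤ k := by exact_mod_cast hk
  have ht : ∀ n : ℕ, 0 ≤ ((n : ℝ) + k) * Δ := fun n => by positivity
  have hκ0 : 0 ≤ momentBound ν := by unfold momentBound; positivity
  have h4 : ∀ n : ℕ, ∫ ω, X ((n + k) * Δ) ω i ^ 4 ∂P ≤ (ν : ℝ) ^ 4 := fun n =>
    hX.integral_pow_four_le hν (ht n) i
  have L4 : ∀ n : ℕ, MemLp (fun ω => X ((n + k) * Δ) ω i) 4 P := fun n => hX.memLp_apply (ht n) i
  have e : ∀ ω, shiftedMean X N Δ k ω i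
      = 1 / (N : ℝ) * ∑ n ∈ Finset.Icc 1 N, X ((n + k) * Δ) ω i := fun ω => by
    simp [shiftedMean, Finset.sum_apply]
  simp only [e]
  refine integral_sq_mean_sub_le hN (fun n _ => (L4 n).mono_exponent (by norm_num))
    (fun n _ => hX.integral_apply (ht n) i) hX.decorrelation.pos hX.decorrelation.antitone
    hX.decorrelation.integrable (by positivity) le_rfl hΔ hΔ1 ?_ ?_
  · intro a _ b _
    have h1 := abs_integral_mul_le_of_four (L4 a) (L4 b) (h4 a) (h4 b)
    have h2 := abs_integral_le_of_four (L4 a) (h4 a)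
    have h3 := abs_integral_le_of_four (L4 b) (h4 b)
    refine (abs_sub _ _).trans ?_
    rw [abs_mul, sq]
    exact add_le_add h1 (mul_le_mul h2 h3 (abs_nonneg _) hκ0)
  · intro a _ b _ hab
    have := hX.decorrelation.abs_sub_le (a := (a + k) * Δ) (b := (a + k) * Δ) (c := (b + k) * Δ)
      (d := (b + k) * Δ) (ht a) le_rfl (by nlinarith) le_rfl (G := fun ω => X ((a + k) * Δ) ω i)
      (H := fun ω => X ((b + k) * Δ) ω i) (Or.inl ⟨_, ⟨le_rfl, le_rfl⟩, i, rfl⟩)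
      (Or.inl ⟨_, ⟨le_rfl, le_rfl⟩, i, rfl⟩)
    rwa [show ((b : ℝ) + k) * Δ - (a + k) * Δ = (b - a) * Δ - 0 by ring] at this

lemma IsAdmissibleProcess.integral_sq_lagged_sub_le (hX : IsAdmissibleProcess P X f)
    {ν : ℝ≥0} (hν : eLpNorm (X 0) 4 P ≤ ν) {k : ℤ} (hk : 0 ≤ k) {Δ B : ℝ}
    (hΔ : 0 < Δ) (hΔ1 : Δ ≤ 1) (hB : k * Δ ≤ B) {N : ℕ} (hN : 1 ≤ N) (i j : Fin r) :
    ∫ ω, (1 / (N : ℝ) * ∑ n ∈ Finset.Icc 1 N, X (n * Δ) ω i * X ((n + k) * Δ) ω j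
        - ∫ ω, X 0 ω i * X (k * Δ) ω j ∂P) ^ 2 ∂P
      ≤ 2 * ((momentBound ν + momentBound ν ^ 2) * (B + 4) + ∫ T in Ioi (1 : ℝ), f T)
        / (N * Δ) := by
  have hk' : (0 : ℝ) ≤ k := by exact_mod_cast hk
  have hkΔ : 0 ≤ k * Δ := by positivity
  have ht0 : ∀ n : ℕ, 0 ≤ (n : ℝ) * Δ := fun n => by positivity
  have ht : ∀ n : ℕ, 0 ≤ ((n : ℝ) + k) * Δ := fun n => by positivity
  have hκ0 : 0 ≤ momentBound ν := by unfold momentBound; positivity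
  have h40 : ∀ n : ℕ, ∫ ω, X (n * Δ) ω i ^ 4 ∂P ≤ (ν : ℝ) ^ 4 := fun n =>
    hX.integral_pow_four_le hν (ht0 n) i
  have h4 : ∀ n : ℕ, ∫ ω, X ((n + k) * Δ) ω j ^ 4 ∂P ≤ (ν : ℝ) ^ 4 := fun n =>
    hX.integral_pow_four_le hν (ht n) j
  have L40 : ∀ n : ℕ, MemLp (fun ω => X (n * Δ) ω i) 4 P := fun n => hX.memLp_apply (ht0 n) i
  have L4 : ∀ n : ℕ, MemLp (fun ω => X ((n + k) * Δ) ω j) 4 P := fun n => hX.memLp_apply (ht n) j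
  refine integral_sq_mean_sub_le (Y := fun n ω => X (n * Δ) ω i * X ((n + k) * Δ) ω j) hN
    (fun n _ => (L40 n).mul_of_four (L4 n)) (fun n _ => ?_) hX.decorrelation.pos
    hX.decorrelation.antitone hX.decorrelation.integrable (by positivity) (hkΔ.trans hB) hΔ hΔ1
    ?_ ?_
  · rw [← hX.integral_mul_apply (ht0 n) hkΔ i j, add_mul]
  · intro a _ b _
    have h1 := abs_integral_mul_mul_le (L40 a) (L4 a) (L40 b) (L4 b) (h40 a) (h4 a) (h40 b) (h4 b)
    have h2 := abs_integral_mul_le_of_four (L40 a) (L4 a) (h40 a) (h4 a)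
    have h3 := abs_integral_mul_le_of_four (L40 b) (L4 b) (h40 b) (h4 b)
    refine (abs_sub _ _).trans ?_
    rw [abs_mul, sq]
    refine add_le_add (h1.trans ?_) (mul_le_mul h2 h3 (abs_nonneg _) hκ0)
    unfold momentBound; linarith
  · intro a _ b _ hab
    have hgap : ((a : ℝ) + k) * Δ < b * Δ := by nlinarith
    -- The product with index `a` lives on `[aΔ, (a + k)Δ]`, so the gap is `(b - a)Δ - kΔ`, at least
    -- `(b - a)Δ - B`; monotonicity of `f` then applies.
    have h := hX.decorrelation.abs_sub_le (a := a * Δ) (b := (a + k) * Δ) (c := b * Δ)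
      (d := (b + k) * Δ) (ht0 a) (by nlinarith) hgap (by nlinarith)
      (G := fun ω => X (a * Δ) ω i * X ((a + k) * Δ) ω j)
      (H := fun ω => X (b * Δ) ω i * X ((b + k) * Δ) ω j)
      (Or.inr ⟨_, ⟨le_rfl, by nlinarith⟩, _, ⟨by nlinarith, le_rfl⟩, i, j, rfl⟩)
      (Or.inr ⟨_, ⟨le_rfl, by nlinarith⟩, _, ⟨by nlinarith, le_rfl⟩, i, j, rfl⟩)
    refine h.trans (hX.decorrelation.antitone ?_ ?_ ?_)
    · simp only [mem_Ioi]; linarith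
    · simp only [mem_Ioi]; linarith
    · linarith [add_mul (a : ℝ) k Δ, sub_mul (b : ℝ) a Δ]

lemma abs_round_div_mul_sub_le {Δ : ℝ} (hΔ : 0 < Δ) (u : ℝ) :
    |(round (u / Δ) : ℝ) * Δ - u| ≤ Δ / 2 := by
  have h := abs_sub_round (u / Δ)
  calc |(round (u / Δ) : ℝ) * Δ - u| = |u / Δ - round (u / Δ)| * Δ := by
        rw [← abs_of_pos hΔ, ← abs_mul, abs_of_pos hΔ, abs_sub_comm]
        congr 1
        field_simp
    _ ≤ 1 / 2 * Δ := by gcongr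
    _ = Δ / 2 := by ring

/-- Cauchy–Schwarz for five terms: the difference of the two sides is the sum of the ten squares
supplied. -/
lemma sq_sub_sub_sub_le (p q x y z : ℝ) :
    (p + q - x - y - z) ^ 2 ≤ 5 * (p ^ 2 + q ^ 2 + x ^ 2 + y ^ 2 + z ^ 2) := by
  linarith [sq_nonneg (p - q), sq_nonneg (p + x), sq_nonneg (p + y), sq_nonneg (p + z),
    sq_nonneg (q + x), sq_nonneg (q + y), sq_nonneg (q + z), sq_nonneg (x - y),
    sq_nonneg (x - z), sq_nonneg (y - z)]

/-- The quadratic error of each entry of the empirical covariance matrix. -/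
theorem IsAdmissibleProcess.integral_sq_entry_le (hX : IsAdmissibleProcess P X f)
    {ν L : ℝ≥0} (hν : eLpNorm (X 0) 4 P ≤ ν) {I A : ℝ} (hI : ∫ T in Ioi (1 : ℝ), f T ≤ I)
    (hL : ∀ i j, LipschitzOnWith L (fun u => laggedCov P X u i j) (Icc 0 (A + 1)))
    {Δ : ℝ} (hΔ : 0 < Δ) (hΔ1 : Δ ≤ 1) {N : ℕ} (hN : 1 ≤ N) {u : ℝ} (hu : u ∈ Icc 0 A)
    (i j : Fin r) :
    MemLp (fun ω => empiricalCov X N Δ u ω i j - laggedCov P X u i j) 2 P ∧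
    ∫ ω, (empiricalCov X N Δ u ω i j - laggedCov P X u i j) ^ 2 ∂P
      ≤ fluctuationConst A I (momentBound ν) / (N * Δ) + 5 * (L * Δ) ^ 2 := by
  have hN0 : (0 : ℝ) < N := by exact_mod_cast hN
  set k := round (u / Δ) with hkdef
  have hround := abs_round_div_mul_sub_le hΔ u
  rw [← hkdef] at hround
  have hk : 0 ≤ k := by
    rw [hkdef, round_eq]
    exact Int.floor_nonneg.2 (by have := div_nonneg hu.1 hΔ.le; linarith)
  have hk' : (0 : ℝ) ≤ k := by exact_mod_cast hk
  have hkΔ : 0 ≤ k * Δ := by positivity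
  -- Rounding may push the lag beyond `A`, by at most `Δ / 2`; this is why the Lipschitz bound is
  -- assumed on `[0, A + 1]`.
  have hkA : k * Δ ≤ A + 1 := by
    have := (abs_le.1 hround).2
    linarith [hu.2]
  have ht0 : ∀ n : ℕ, 0 ≤ (n : ℝ) * Δ := fun n => by positivity
  have ht : ∀ n : ℕ, 0 ≤ ((n : ℝ) + k) * Δ := fun n => by positivity
  set κ := momentBound ν with hκ
  have hκ0 : 0 ≤ κ := by rw [hκ]; unfold momentBound; positivity
  have hmom : ∀ t, 0 ≤ t → ∀ i, ∫ ω, X t ω i ^ 4 ∂P ≤ κ := fun t ht i =>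
    (hX.integral_pow_four_le hν ht i).trans (by rw [hκ]; unfold momentBound; linarith)
  have hμ : ∀ i, |∫ ω, X 0 ω i ∂P| ≤ κ := fun i =>
    abs_integral_le_of_four (hX.memLp_apply le_rfl i) (hX.integral_pow_four_le hν le_rfl i)
  set μi := ∫ ω, X 0 ω i ∂P with hμi
  set μj := ∫ ω, X 0 ω j ∂P with hμj
  set q := ∫ ω, X 0 ω i * X (k * Δ) ω j ∂P with hq
  set V : Ω → ℝ := fun ω => 1 / (N : ℝ) * ∑ n ∈ Finset.Icc 1 N,
    X (n * Δ) ω i * X ((n + k) * Δ) ω j - q with hV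
  set Z : Ω → ℝ := fun ω => shiftedMean X N Δ 0 ω i - μi with hZ
  set Y : Ω → ℝ := fun ω => shiftedMean X N Δ k ω j - μj with hY
  set b := laggedCov P X (k * Δ) i j - laggedCov P X u i j with hb
  have hbias : b ^ 2 ≤ (L * Δ) ^ 2 := by
    have h := (hL i j).dist_le_mul (k * Δ) ⟨hkΔ, hkA⟩ u ⟨hu.1, by linarith [hu.2]⟩
    rw [Real.dist_eq, Real.dist_eq] at h
    rw [← sq_abs b]
    have h2 : |b| ≤ L * Δ := h.trans (by gcongr; linarith)
    gcongr
  have hentry : ∀ ω, empiricalCov X N Δ u ω i j - laggedCov P X u i j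
      = V ω + b - Z ω * Y ω - μj * Z ω - μi * Y ω := by
    intro ω
    rw [empiricalCov_apply]
    simp only [hV, hZ, hY, hb, laggedCov, Matrix.of_apply, ← hkdef, ← hq, ← hμi, ← hμj]
    ring
  have LV : MemLp V 2 P :=
    ((memLp_finsetSum _ fun n _ => (hX.memLp_apply (ht0 n) i).mul_of_four
      (hX.memLp_apply (ht n) j)).const_mul _).sub (memLp_const q)
  have LZ : MemLp Z 4 P :=
    (memLp_shiftedMean fun n _ => by simpa using hX.memLp_apply (ht0 n) i).sub (memLp_const μi)
  have LY : MemLp Y 4 P :=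
    (memLp_shiftedMean fun n _ => hX.memLp_apply (ht n) j).sub (memLp_const μj)
  have LE : MemLp (fun ω => empiricalCov X N Δ u ω i j - laggedCov P X u i j) 2 P :=
    (memLp_empiricalCov_apply (fun n _ => hX.memLp_apply (ht0 n) i)
      (fun n _ => hX.memLp_apply (ht n) j)).sub (memLp_const _)
  refine ⟨LE, ?_⟩
  have bV : ∫ ω, V ω ^ 2 ∂P ≤ 2 * ((κ + κ ^ 2) * (A + 1 + 4) + I) / (N * Δ) :=
    (hX.integral_sq_lagged_sub_le hν hk hΔ hΔ1 hkA hN i j).trans (by gcongr)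
  have bZ2 : ∫ ω, Z ω ^ 2 ∂P ≤ 2 * ((κ + κ ^ 2) * (0 + 4) + I) / (N * Δ) :=
    (hX.integral_sq_shiftedMean_sub_le hν le_rfl hΔ hΔ1 hN i).trans (by gcongr)
  have bY2 : ∫ ω, Y ω ^ 2 ∂P ≤ 2 * ((κ + κ ^ 2) * (0 + 4) + I) / (N * Δ) :=
    (hX.integral_sq_shiftedMean_sub_le hν hk hΔ hΔ1 hN j).trans (by gcongr)
  have bZ4 : ∫ ω, Z ω ^ 4 ∂P ≤ 12 * (4 * (8 * (κ + κ ^ 4))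
      + ((1 + 2 * κ) ^ 2 + (1 + 8 * (κ + κ ^ 4))) * I) / (N * Δ) :=
    (hX.integral_shiftedMean_sub_pow_four_le hmom rfl rfl le_rfl hΔ hΔ1 hN i hμi.symm
      (hμ i)).trans (by gcongr)
  have bY4 : ∫ ω, Y ω ^ 4 ∂P ≤ 12 * (4 * (8 * (κ + κ ^ 4))
      + ((1 + 2 * κ) ^ 2 + (1 + 8 * (κ + κ ^ 4))) * I) / (N * Δ) :=
    (hX.integral_shiftedMean_sub_pow_four_le hmom rfl rfl hk hΔ hΔ1 hN j hμj.symm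
      (hμ j)).trans (by gcongr)
  have iV := LV.integrable_sq
  have iZ4 := LZ.integrable_pow_four
  have iY4 := LY.integrable_pow_four
  have iZ2 := (LZ.mono_exponent (p := 2) (by norm_num)).integrable_sq
  have iY2 := (LY.mono_exponent (p := 2) (by norm_num)).integrable_sq
  have i4 : Integrable (fun ω => Z ω ^ 4 + Y ω ^ 4) P := iZ4.add iY4
  have i2 : Integrable (fun ω => Z ω ^ 2 + Y ω ^ 2) P := iZ2.add iY2
  have i5 : Integrable (fun ω => V ω ^ 2 + (L * Δ) ^ 2) P := iV.add (integrable_const _)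
  have i6 : Integrable (fun ω => V ω ^ 2 + (L * Δ) ^ 2 + 1 / 2 * (Z ω ^ 4 + Y ω ^ 4)) P :=
    i5.add (i4.const_mul _)
  have i7 : Integrable (fun ω => V ω ^ 2 + (L * Δ) ^ 2 + 1 / 2 * (Z ω ^ 4 + Y ω ^ 4)
      + κ ^ 2 * (Z ω ^ 2 + Y ω ^ 2)) P := i6.add (i2.const_mul _)
  have hμ2 : ∀ {x : ℝ}, |x| ≤ κ → x ^ 2 ≤ κ ^ 2 := fun {x} hx => by
    rw [← sq_abs]; gcongr
  calc ∫ ω, (empiricalCov X N Δ u ω i j - laggedCov P X u i j) ^ 2 ∂P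
      ≤ ∫ ω, 5 * (V ω ^ 2 + (L * Δ) ^ 2 + 1 / 2 * (Z ω ^ 4 + Y ω ^ 4)
        + κ ^ 2 * (Z ω ^ 2 + Y ω ^ 2)) ∂P := by
        refine integral_mono LE.integrable_sq (i7.const_mul 5) fun ω => ?_
        simp only [hentry]
        have h1 : (V ω + b - Z ω * Y ω - μj * Z ω - μi * Y ω) ^ 2
            ≤ 5 * (V ω ^ 2 + b ^ 2 + (Z ω * Y ω) ^ 2 + (μj * Z ω) ^ 2 + (μi * Y ω) ^ 2) := by
          exact sq_sub_sub_sub_le _ _ _ _ _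
        have h2 : (Z ω * Y ω) ^ 2 ≤ 1 / 2 * (Z ω ^ 4 + Y ω ^ 4) := by
          nlinarith [sq_nonneg (Z ω ^ 2 - Y ω ^ 2)]
        have h3 : (μj * Z ω) ^ 2 ≤ κ ^ 2 * Z ω ^ 2 := by
          rw [mul_pow]; exact mul_le_mul_of_nonneg_right (hμ2 (hμ j)) (sq_nonneg _)
        have h4 : (μi * Y ω) ^ 2 ≤ κ ^ 2 * Y ω ^ 2 := by
          rw [mul_pow]; exact mul_le_mul_of_nonneg_right (hμ2 (hμ i)) (sq_nonneg _)
        linarith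
    _ = 5 * (∫ ω, V ω ^ 2 ∂P + (L * Δ) ^ 2 + 1 / 2 * (∫ ω, Z ω ^ 4 ∂P + ∫ ω, Y ω ^ 4 ∂P)
        + κ ^ 2 * (∫ ω, Z ω ^ 2 ∂P + ∫ ω, Y ω ^ 2 ∂P)) := by
        rw [integral_const_mul, integral_add i6 (i2.const_mul _), integral_add i5 (i4.const_mul _),
          integral_add iV (integrable_const _), integral_const_mul, integral_const_mul,
          integral_add iZ4 iY4, integral_add iZ2 iY2]
        simp
    _ ≤ 5 * (2 * ((κ + κ ^ 2) * (A + 1 + 4) + I) / (N * Δ) + (L * Δ) ^ 2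
        + 1 / 2 * (12 * (4 * (8 * (κ + κ ^ 4))
          + ((1 + 2 * κ) ^ 2 + (1 + 8 * (κ + κ ^ 4))) * I) / (N * Δ)
          + 12 * (4 * (8 * (κ + κ ^ 4))
          + ((1 + 2 * κ) ^ 2 + (1 + 8 * (κ + κ ^ 4))) * I) / (N * Δ))
        + κ ^ 2 * (2 * ((κ + κ ^ 2) * (0 + 4) + I) / (N * Δ)
          + 2 * ((κ + κ ^ 2) * (0 + 4) + I) / (N * Δ))) := by gcongr
    _ = _ := by
        unfold fluctuationConst
        ring

end UpperBound

/-! ### From entries to the matrix norm, and the choice of time step -/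

section UpperBound

lemma covError_le_sum {Ω : Type*} [MeasurableSpace Ω] {P : Measure Ω} {r : ℕ}
    {X : ℝ → Ω → Fin r → ℝ} {N : ℕ} {Δ u : ℝ} {s : ℝ≥0∞}
    (hm : ∀ i j, AEStronglyMeasurable
      (fun ω => empiricalCov X N Δ u ω i j - laggedCov P X u i j) P)
    (hs : ∀ i j, eLpNorm (fun ω => empiricalCov X N Δ u ω i j - laggedCov P X u i j) 2 P ≤ s) :
    covError P X N Δ u ≤ (r : ℝ≥0∞) ^ 2 * s := by
  set E : Fin r × Fin r → Ω → ℝ := fun p ω =>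
    ‖empiricalCov X N Δ u ω p.1 p.2 - laggedCov P X u p.1 p.2‖ with hE
  calc covError P X N Δ u ≤ eLpNorm (∑ p, E p) 2 P := by
        refine eLpNorm_mono_real fun ω => ?_
        have h0 : ∀ p, 0 ≤ E p ω := fun p => norm_nonneg _
        rw [Finset.sum_apply]
        refine (pi_norm_le_iff_of_nonneg (Finset.sum_nonneg fun p _ => h0 p)).2 fun i =>
          (pi_norm_le_iff_of_nonneg (Finset.sum_nonneg fun p _ => h0 p)).2 fun j => ?_
        exact Finset.single_le_sum (f := fun p => E p ω) (fun p _ => h0 p)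
          (Finset.mem_univ (i, j))
    _ ≤ ∑ p, eLpNorm (E p) 2 P :=
        eLpNorm_sum_le (fun p _ => (hm p.1 p.2).norm) (by norm_num)
    _ ≤ ∑ _p : Fin r × Fin r, s := by
        refine Finset.sum_le_sum fun p _ => ?_
        rw [hE, eLpNorm_norm]
        exact hs p.1 p.2
    _ = (r : ℝ≥0∞) ^ 2 * s := by
        simp [sq]

lemma IsAdmissibleProcess.eventually_covError_le {Ω : Type*} [MeasurableSpace Ω] {P : Measure Ω}
    [IsProbabilityMeasure P] {r : ℕ} {X : ℝ → Ω → Fin r → ℝ} {f : ℝ → ℝ}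
    (hX : IsAdmissibleProcess P X f) {A I c : ℝ} {ν L : ℝ≥0} (hc : 0 < c)
    (hν : eLpNorm (X 0) 4 P ≤ ν) (hI : ∫ T in Ioi (1 : ℝ), f T ≤ I)
    (hL : ∀ i j, LipschitzOnWith L (fun u => laggedCov P X u i j) (Icc 0 (A + 1)))
    {N : ℝ → ℕ} {Δ : ℝ → ℝ} (hΔ : ∀ ε, 0 < ε → 0 < Δ ε) (hN : Tendsto N (𝓝[>] 0) atTop)
    (hΔN : Tendsto (fun ε => Δ ε / (1 / (N ε : ℝ) ^ (1 / 3 : ℝ))) (𝓝[>] 0) (𝓝 c)) :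
    ∀ᶠ ε in 𝓝[>] (0 : ℝ), ∀ u ∈ Icc 0 A, covError P X (N ε) (Δ ε) u
      ≤ ENNReal.ofReal ((r ^ 2 * √(2 * fluctuationConst A I (momentBound ν) / c
        + 20 * (L * c) ^ 2) + 1) * (1 / (N ε : ℝ) ^ (1 / 3 : ℝ))) := by
  have hy : Tendsto (fun ε => (N ε : ℝ) ^ (1 / 3 : ℝ)) (𝓝[>] 0) atTop :=
    (tendsto_rpow_atTop (by norm_num)).comp (tendsto_natCast_atTop_atTop.comp hN)
  -- With `y = N^(1/3)`, eventually `c / 2 < Δ y < 2c`, and `y ≥ 2c` then forces `Δ ≤ 1`. The lower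
  -- bound controls `1 / (NΔ)`, the upper one the bias.
  filter_upwards [self_mem_nhdsWithin, hN.eventually_ge_atTop 1,
    hy.eventually_ge_atTop (2 * c), hΔN.eventually_lt_const (show c < 2 * c by linarith),
    hΔN.eventually_const_lt (show c / 2 < c by linarith)] with ε hε hN1 hyc hup hlow u hu
  have hΔ0 := hΔ ε hε
  have hN0 : (0 : ℝ) < N ε := by exact_mod_cast hN1
  set y := (N ε : ℝ) ^ (1 / 3 : ℝ) with hydef
  have hy0 : 0 < y := Real.rpow_pos_of_pos hN0 _
  have hy3 : y ^ 3 = N ε := cast_eq_rpow_third_pow _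
  rw [div_div_eq_mul_div, div_one] at hup hlow
  have hΔ1 : Δ ε ≤ 1 := by
    by_contra h
    push Not at h
    nlinarith
  have hA : 0 ≤ A := hu.1.trans hu.2
  have hI0 : 0 ≤ I := le_trans (setIntegral_nonneg measurableSet_Ioi fun T hT =>
    (hX.decorrelation.pos T (zero_lt_one.trans hT)).le) hI
  have hF : 0 ≤ fluctuationConst A I (momentBound ν) := by
    have : 0 ≤ momentBound ν := by unfold momentBound; positivity
    unfold fluctuationConst
    positivity
  set F := fluctuationConst A I (momentBound ν) with hFdef
  have hC1 : 0 ≤ 2 * F / c + 20 * (L * c) ^ 2 := by positivity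
  have hentry : ∀ i j, eLpNorm (fun ω => empiricalCov X (N ε) (Δ ε) u ω i j
      - laggedCov P X u i j) 2 P ≤ ENNReal.ofReal (√(2 * F / c + 20 * (L * c) ^ 2) * (1 / y)) := by
    intro i j
    obtain ⟨hm, hle⟩ := hX.integral_sq_entry_le hν hI hL hΔ0 hΔ1 hN1 hu i j
    rw [eLpNorm_two_eq_sqrt hm]
    refine ENNReal.ofReal_le_ofReal (Real.sqrt_le_left (by positivity) |>.2 (hle.trans ?_))
    rw [mul_pow (√_), Real.sq_sqrt hC1, ← hFdef]
    have h1 : F / (N ε * Δ ε) ≤ 2 * F / c * (1 / y) ^ 2 := by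
      have h2 : c / 2 * y ^ 2 ≤ N ε * Δ ε := by rw [← hy3]; nlinarith [sq_nonneg y]
      calc F / (N ε * Δ ε) ≤ F / (c / 2 * y ^ 2) := by gcongr
        _ = _ := by field_simp
    have h2 : 5 * (L * Δ ε) ^ 2 ≤ 20 * (L * c) ^ 2 * (1 / y) ^ 2 := by
      have h3 : Δ ε ≤ 2 * c * (1 / y) := by
        rw [mul_one_div, le_div_iff₀ hy0]; exact hup.le
      calc 5 * (L * Δ ε) ^ 2 ≤ 5 * (L * (2 * c * (1 / y))) ^ 2 := by gcongr
        _ = _ := by ring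
    linarith
  refine (covError_le_sum (fun i j =>
    (hX.integral_sq_entry_le hν hI hL hΔ0 hΔ1 hN1 hu i j).1.1) hentry).trans ?_
  rw [← ENNReal.ofReal_natCast, ← ENNReal.ofReal_pow (by positivity),
    ← ENNReal.ofReal_mul (by positivity)]
  refine ENNReal.ofReal_le_ofReal ?_
  have : 0 < 1 / y := by positivity
  nlinarith

end UpperBound

/-! ### The two bounds combined -/

theorem mainTheorem6 (r : ℕ) :
    -- the upper bound, for every scheme with `Δ(ε) ~ N(ε)^{-1/3}`
    (∀ (A I c : ℝ) (ν L : ℝ≥0), 0 < c →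
      ∃ C : ℝ, 0 < C ∧
        ∀ (Ω : Type v) [MeasurableSpace Ω] (P : Measure Ω) [IsProbabilityMeasure P]
          (X : ℝ → Ω → Fin r → ℝ) (f : ℝ → ℝ),
          IsAdmissibleProcess P X f →
          eLpNorm (X 0) 4 P ≤ ν →
          (∫ T in Ioi (1 : ℝ), f T) ≤ I →
          (∀ i j, LipschitzOnWith L (fun u => laggedCov P X u i j) (Icc 0 (A + 1))) →
          ∀ (N : ℝ → ℕ) (Δ : ℝ → ℝ),
            (∀ ε, 0 < ε → 0 < Δ ε) →
            Tendsto N (𝓝[>] 0) atTop →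
            Tendsto (fun ε => Δ ε / (1 / (N ε : ℝ) ^ (1 / 3 : ℝ))) (𝓝[>] 0) (𝓝 c) →
            ∀ᶠ ε in 𝓝[>] (0 : ℝ), ∀ u ∈ Icc 0 A,
              covError P X (N ε) (Δ ε) u ≤ ENNReal.ofReal (C * (1 / (N ε : ℝ) ^ (1 / 3 : ℝ)))) ∧
    -- optimality: a Gaussian process for which no scheme does better, uniformly on `[0, A]`
    (0 < r →
      ∃ (Ω : Type) (_ : MeasurableSpace Ω) (P : Measure Ω) (_ : IsProbabilityMeasure P)
        (X : ℝ → Ω → Fin r → ℝ) (f : ℝ → ℝ),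
        IsAdmissibleProcess P X f ∧
        IsGaussianProcess (fun t : ℝ≥0 => X t) P ∧
        ∀ A : ℝ, 0 < A →
          ∃ c : ℝ, 0 < c ∧
            ∀ (N : ℝ → ℕ) (Δ : ℝ → ℝ), IsAdaptiveScheme N Δ →
              ∀ᶠ ε in 𝓝[>] (0 : ℝ), ∃ u ∈ Icc 0 A,
                ENNReal.ofReal (c * (1 / (N ε : ℝ) ^ (1 / 3 : ℝ))) ≤
                  covError P X (N ε) (Δ ε) u) := by
  -- The summand `1` keeps the constant positive, for instance when `r = 0`.
  refine ⟨fun A I c ν L hc => ⟨r ^ 2 * √(2 * fluctuationConst A I (momentBound ν) / c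
      + 20 * (L * c) ^ 2) + 1, by positivity, fun Ω _ P _ X f hX hν hI hL N Δ hΔ hN hΔN =>
      hX.eventually_covError_le hc hν hI hL hΔ hN hΔN⟩, fun hr => ?_⟩
  obtain ⟨Ω, mΩ, P, hP, W, hW⟩ := exists_isonormal (WhiteNoiseSpace r)
  exact ⟨Ω, mΩ, P, hP, movingAverage W, _, isAdmissibleProcess_movingAverage hW,
    isGaussianProcess_movingAverage hW, fun A hA => ⟨1 / 8, by norm_num, fun N Δ h =>
      eventually_le_covError_movingAverage hW ⟨0, hr⟩ hA h⟩⟩
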